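/- Let $\sigma>0$, $a\in\mathbb R$, and let $(X_t)_{t\ge 1}$ be a strictly stationary Gaussian AR(1) process: $X_{t+1}=aX_t+\varepsilon_{t+1}$ almost surely for $t\ge 1$, where $\varepsilon_2,\varepsilon_3,\dots$ are i.i.d. $N(0,\sigma^2)$ and $X_1$ is independent of $(\varepsilon_2,\varepsilon_3,\dots)$. For $b\in\mathbb R$ and $v>0$ put $$f_{b,v}(x,y,z)=\frac1{2\pi v}\exp\Big(-\frac{(y-bx)^2+(z-by)^2}{2v}\Big),\qquad s_{b,v}(x,y,z)=\frac{2f_{b,v}(x,y,z)}{f_{b,v}(x,y,z)+f_{b,v}(x,z,y)},$$ and let $S_4=s_{a,\sigma^2}(X_2,X_3,X_4)$ be the oracle betting score. For $m\ge 2$ let $$\hat a_m=\frac{\sum_{i=2}^m X_iX_{i-1}}{\sum_{i=1}^{m-1}X_i^2},\qquad \hat\sigma^2_m=\frac1{m-1}\sum_{i=2}^m (X_i-\hat a_mX_{i-1})^2$$ be the least-squares estimates, let $\hat S_{2i}=s_{\hat a_{2i-2},\,\hat\sigma^2_{2i-2}}(X_{2i-2},X_{2i-1},X_{2i})$ for $i\ge2$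 be the plug-in score, with $\hat S_{2i}=1$ (no bet) when $\hat\sigma^2_{2i-2}=0$ (this happens almost surely for $i=2$, and almost surely for no $i\ge3$), and let $W_{2n}=\prod_{i=2}^n\hat S_{2i}$ be the plug-in wealth. Then $\log S_4$ is integrable and, with $r^*=\tfrac12\,\mathbb E[\log S_4]$, $$\frac{\log W_{2n}}{2n}\longrightarrow r^*\quad\text{almost surely as } n\to\infty .$$ Moreover $r^*\ge0$, and $r^*=0$ if and only if $a=0$, in which case $X_1,X_2,\dots$ are i.i.d. $N(0,\sigma^2)$ (so the null hypothesis of exchangeability holds). -/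

import Mathlib

open MeasureTheory ProbabilityTheory Filter Topology

noncomputable section

/-- `X 1, X 2, …` is a (strictly) stationary Gaussian AR(1) process on `(Ω, P)` with coefficient `a`
and innovations `ε 2, ε 3, …` that are i.i.d. `N(0, σ²)`: `X (t+1) = a * X t + ε (t+1)` for `t ≥ 1`.
Time starts at `1`, so the values `X 0`, `ε 0` and `ε 1` play no role.
As always for an AR(1) model, an innovation is independent of the past of the process; together with
the independence of the innovations this says that `X 1` is independent of `(ε 2, ε 3, …)`.
Nothing is required of `a` and nothing of the law of `X 1` beyond stationarity. -/
structure IsStationaryGaussianAR1 {Ω : Type*} [MeasurableSpace Ω] (P : Measure Ω)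
    (X ε : ℕ → Ω → ℝ) (a σ : ℝ) : Prop where
  measurable_X : ∀ t, 1 ≤ t → Measurable (X t)
  measurable_innovation : ∀ t, 2 ≤ t → Measurable (ε t)
  innovation_law : ∀ t, 2 ≤ t → HasLaw (ε t) (gaussianReal 0 ⟨σ ^ 2, sq_nonneg σ⟩) P
  innovation_indep : iIndepFun (fun t : ℕ => ε (t + 2)) P
  initial_indep : IndepFun (X 1) (fun ω (t : ℕ) => ε (t + 2) ω) P
  recursion : ∀ t, 1 ≤ t → ∀ᵐ ω ∂P, X (t + 1) ω = a * X t ω + ε (t + 1) ω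
  stationary : ∀ h : ℕ,
    IdentDistrib (fun ω (t : ℕ) => X (t + 1 + h) ω) (fun ω (t : ℕ) => X (t + 1) ω) P P

/-- `f(x, y, z)`: the density at `(y, z)` of the next two observations of a Gaussian AR(1) process
with coefficient `a` and innovation variance `v = σ²`, given that the present one is `x`. -/
def arDensity (a v x y z : ℝ) : ℝ :=
  1 / (2 * Real.pi * v) *
    Real.exp (-(1 / (2 * v)) * (y - a * x) ^ 2 - 1 / (2 * v) * (z - a * y) ^ 2)

/-- The likelihood ratio `2 f(x, y, z) / (f(x, y, z) + f(x, z, y))` of the order `(y, z)`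
of the unordered pair `{y, z}` that follows `x`. -/
def pairScore (a v x y z : ℝ) : ℝ :=
  2 * arDensity a v x y z / (arDensity a v x y z + arDensity a v x z y)

/-- The oracle betting score `S_k`, `k = 4, 6, …`, which uses the true parameters `a`, `v = σ²`. -/
def oracleScore {Ω : Type*} (a v : ℝ) (X : ℕ → Ω → ℝ) (k : ℕ) (ω : Ω) : ℝ :=
  pairScore a v (X (k - 2) ω) (X (k - 1) ω) (X k ω)

/-- The least squares estimate `â_m` of the coefficient from `X 1, …, X m`. -/
def lsCoef {Ω : Type*} (X : ℕ → Ω → ℝ) (m : ℕ) (ω : Ω) : ℝ :=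
  (∑ i ∈ Finset.Icc 2 m, X i ω * X (i - 1) ω) / ∑ i ∈ Finset.Icc 1 (m - 1), X i ω ^ 2

/-- The estimate `σ̂²_m` of the innovation variance from `X 1, …, X m`. -/
def lsVar {Ω : Type*} (X : ℕ → Ω → ℝ) (m : ℕ) (ω : Ω) : ℝ :=
  1 / ((m : ℝ) - 1) * ∑ i ∈ Finset.Icc 2 m, (X i ω - lsCoef X m ω * X (i - 1) ω) ^ 2

open Classical in
/-- The plug-in betting score `Ŝ_k`, `k = 4, 6, …`: the oracle score with `a` and `σ²` replaced by
their estimates from `X 1, …, X (k-2)`. If the estimated variance is `0`, the estimated density does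
not exist and no bet is placed (the score is `1`). Since `X 2` is an exact multiple of `X 1`, this
is what happens almost surely at `k = 4`; later it almost surely does not happen. -/
def plugInScore {Ω : Type*} (X : ℕ → Ω → ℝ) (k : ℕ) (ω : Ω) : ℝ :=
  if lsVar X (k - 2) ω = 0 then 1
  else pairScore (lsCoef X (k - 2) ω) (lsVar X (k - 2) ω) (X (k - 2) ω) (X (k - 1) ω) (X k ω)

/-- The plug-in wealth `W_{2n} = ∏_{i=2}^n Ŝ_{2i}` after `n` rounds (no bet in the first round). -/
def pairWealth {Ω : Type*} (X : ℕ → Ω → ℝ) (n : ℕ) (ω : Ω) : ℝ :=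
  ∏ i ∈ Finset.Icc 2 n, plugInScore X (2 * i) ω

/-- The growth rate `r* = ½ E[log S_4]`. -/
def growthRate {Ω : Type*} [MeasurableSpace Ω] (P : Measure Ω) (X : ℕ → Ω → ℝ) (a v : ℝ) : ℝ :=
  1 / 2 * ∫ ω, Real.log (oracleScore a v X 4 ω) ∂P

end

open scoped ENNReal NNReal

/-! ### Averages of real sequences -/

/-- A sum splits along the residue classes modulo `L`. -/
theorem sum_range_eq_sum_residues (y : ℕ → ℝ) {L : ℕ} (hL : 0 < L) (N : ℕ) :
    ∑ t ∈ Finset.range N, y t =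
      ∑ r ∈ Finset.range L, ∑ k ∈ Finset.range ((N + (L - 1 - r)) / L), y (k * L + r) := by
  induction N with
  | zero =>
    symm
    refine Finset.sum_eq_zero fun r hr => ?_
    rw [Nat.div_eq_of_lt (by have := Finset.mem_range.1 hr; omega)]
    simp
  | succ N ih =>
    rw [Finset.sum_range_succ, ih]
    have hmem : N % L ∈ Finset.range L := Finset.mem_range.2 (Nat.mod_lt _ hL)
    rw [← Finset.add_sum_erase _ _ hmem, ← Finset.add_sum_erase _ _ hmem]
    have hlt := Nat.mod_lt N hL
    have hN : L * (N / L) + N % L = N := Nat.div_add_mod N L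
    have e1 : (N + (L - 1 - N % L)) / L = N / L := by
      rw [Nat.div_eq_iff hL]
      constructor
      · rw [mul_comm]; omega
      · rw [mul_comm]; omega
    have e2 : (N + 1 + (L - 1 - N % L)) / L = N / L + 1 := by
      rw [Nat.div_eq_iff hL]
      have : (N / L + 1) * L = L * (N / L) + L := by ring
      constructor
      · omega
      · omega
    rw [e1, e2, Finset.sum_range_succ]
    have e3 : N / L * L + N % L = N := by rw [mul_comm]; exact hN
    rw [e3]
    have e4 : ∀ r ∈ (Finset.range L).erase (N % L),
        (N + 1 + (L - 1 - r)) / L = (N + (L - 1 - r)) / L := by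
      intro r hr
      have hr1 := Finset.ne_of_mem_erase hr
      have hr2 := Finset.mem_range.1 (Finset.mem_of_mem_erase hr)
      rcases lt_or_gt_of_ne hr1 with h | h
      · have hx : (N / L + 1) * L = L * (N / L) + L := by ring
        exact ((Nat.div_eq_iff hL (y := N / L + 1)).2 (by omega)).trans
          ((Nat.div_eq_iff hL (y := N / L + 1)).2 (by omega)).symm
      · have hx : (N / L) * L = L * (N / L) := by ring
        exact ((Nat.div_eq_iff hL (y := N / L)).2 (by omega)).trans
          ((Nat.div_eq_iff hL (y := N / L)).2 (by omega)).symm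
    have e5 : ∑ r ∈ (Finset.range L).erase (N % L),
          ∑ k ∈ Finset.range ((N + 1 + (L - 1 - r)) / L), y (k * L + r) =
        ∑ r ∈ (Finset.range L).erase (N % L),
          ∑ k ∈ Finset.range ((N + (L - 1 - r)) / L), y (k * L + r) :=
      Finset.sum_congr rfl fun r hr => by rw [e4 r hr]
    rw [e5]
    ring

/-- If the averages converge to `l` along each residue class modulo `L`, then they converge
to `l`. -/
theorem tendsto_average_of_residues {y : ℕ → ℝ} {l : ℝ} {L : ℕ} (hL : 0 < L)
    (h : ∀ r < L,
      Tendsto (fun n : ℕ => (∑ k ∈ Finset.range n, y (k * L + r)) / (n : ℝ)) atTop (𝓝 l)) :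
    Tendsto (fun n : ℕ => (∑ i ∈ Finset.range n, y i) / (n : ℝ)) atTop (𝓝 l) := by
  have hL' : (0 : ℝ) < L := by exact_mod_cast hL
  have key : ∀ r ∈ Finset.range L, Tendsto (fun N : ℕ =>
      (∑ k ∈ Finset.range ((N + (L - 1 - r)) / L), y (k * L + r)) / (N : ℝ)) atTop
      (𝓝 (l * (1 / L))) := by
    intro r hr
    have hc : Tendsto (fun N : ℕ => (N + (L - 1 - r)) / L) atTop atTop :=
      (Nat.tendsto_div_const_atTop hL.ne').comp (tendsto_add_atTop_nat _)
    have hq : Tendsto (fun N : ℕ => (((N + (L - 1 - r)) / L : ℕ) : ℝ) / (N : ℝ)) atTop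
        (𝓝 (1 / L)) := by
      have h0 : Tendsto (fun N : ℕ => (1 : ℝ) / (N : ℝ)) atTop (𝓝 0) :=
        tendsto_const_div_atTop_nhds_zero_nat 1
      have hlo : Tendsto (fun N : ℕ => 1 / (L : ℝ) - 1 / (N : ℝ)) atTop (𝓝 (1 / L)) := by
        simpa using (tendsto_const_nhds (x := 1 / (L : ℝ))).sub h0
      have hhi : Tendsto (fun N : ℕ => 1 / (L : ℝ) + 1 / (N : ℝ)) atTop (𝓝 (1 / L)) := by
        simpa using (tendsto_const_nhds (x := 1 / (L : ℝ))).add h0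
      refine tendsto_of_tendsto_of_tendsto_of_le_of_le' hlo hhi ?_ ?_
      · filter_upwards [eventually_gt_atTop 0] with N hN
        have hN' : (0 : ℝ) < N := by exact_mod_cast hN
        have h1 : N < L * ((N + (L - 1 - r)) / L) + L := by
          have := Nat.lt_mul_div_succ (N + (L - 1 - r)) hL
          rw [Nat.mul_succ] at this; omega
        have h1' : (N : ℝ) < L * (((N + (L - 1 - r)) / L : ℕ) : ℝ) + L := by exact_mod_cast h1
        rw [div_sub_div _ _ hL'.ne' hN'.ne', div_le_div_iff₀ (by positivity) hN']
        nlinarith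
      · filter_upwards [eventually_gt_atTop 0] with N hN
        have hN' : (0 : ℝ) < N := by exact_mod_cast hN
        have h1 : L * ((N + (L - 1 - r)) / L) ≤ N + L := by
          have := Nat.mul_div_le (N + (L - 1 - r)) L
          omega
        have h1' : L * (((N + (L - 1 - r)) / L : ℕ) : ℝ) ≤ (N : ℝ) + L := by exact_mod_cast h1
        rw [div_add_div _ _ hL'.ne' hN'.ne', div_le_div_iff₀ hN' (by positivity)]
        nlinarith
    refine (((h r (Finset.mem_range.1 hr)).comp hc).mul hq).congr' ?_
    filter_upwards [hc.eventually (eventually_gt_atTop 0)] with N hN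
    have hN' : ((((N + (L - 1 - r)) / L : ℕ) : ℝ)) ≠ 0 := by exact_mod_cast hN.ne'
    simp only [Function.comp_apply]
    field_simp
  have hs := tendsto_finsetSum _ key
  have hl : ∑ _r ∈ Finset.range L, l * (1 / (L : ℝ)) = l := by
    rw [Finset.sum_const, Finset.card_range, nsmul_eq_mul]; field_simp
  rw [hl] at hs
  refine hs.congr fun N => ?_
  rw [sum_range_eq_sum_residues y hL N, Finset.sum_div]

/-- Averages converge to `l` if, up to a shift and an error that is small on average, they can be
approximated by convergent averages with limits near `l`. -/
theorem tendsto_average_of_approx {x q : ℕ → ℝ} {l K : ℝ} (hq : ∀ i, 0 ≤ q i)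
    (hK : ∀ n : ℕ, ∑ i ∈ Finset.range n, q i ≤ K * ((n : ℝ) + 1))
    (h : ∀ δ > 0, ∃ (M : ℕ) (y : ℕ → ℝ) (l' : ℝ), |l' - l| ≤ δ ∧
      (∀ i, |x (i + M) - y i| ≤ δ * (q (i + M) + q i)) ∧
      Tendsto (fun n : ℕ => (∑ i ∈ Finset.range n, y i) / (n : ℝ)) atTop (𝓝 l')) :
    Tendsto (fun n : ℕ => (∑ i ∈ Finset.range n, x i) / (n : ℝ)) atTop (𝓝 l) := by
  rw [Metric.tendsto_atTop']
  have hK0 : 0 ≤ K := by simpa using hK 0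
  intro η hη
  set δ := η / (8 * (K + 1)) with hδdef
  have hδ : 0 < δ := by positivity
  have hδη : δ * (8 * (K + 1)) = η := by rw [hδdef]; field_simp
  obtain ⟨M, y, l', hl, hxy, hy⟩ := h δ hδ
  have hclose : ∀ᶠ n : ℕ in atTop,
      |(∑ i ∈ Finset.range n, x (i + M)) / (n : ℝ) - l| ≤ η * (7 / 8) := by
    have e1 := Metric.tendsto_nhds.1 hy δ hδ
    filter_upwards [e1, eventually_gt_atTop (M + 2)] with n hn hnM
    have hn0 : (0 : ℝ) < n := by exact_mod_cast (by omega : 0 < n)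
    have hnM' : (M : ℝ) + 2 ≤ n := by exact_mod_cast hnM.le
    rw [Real.dist_eq] at hn
    have b1 : |∑ i ∈ Finset.range n, x (i + M) - ∑ i ∈ Finset.range n, y i| ≤
        δ * (4 * K * n) := by
      rw [← Finset.sum_sub_distrib]
      refine (Finset.abs_sum_le_sum_abs _ _).trans ?_
      refine (Finset.sum_le_sum fun i _ => hxy i).trans ?_
      rw [← Finset.mul_sum, Finset.sum_add_distrib]
      refine mul_le_mul_of_nonneg_left ?_ hδ.le
      have c1 : ∑ i ∈ Finset.range n, q (i + M) ≤ K * ((n : ℝ) + M + 1) := by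
        have := hK (M + n)
        rw [Finset.sum_range_add] at this
        have c2 : 0 ≤ ∑ i ∈ Finset.range M, q i := Finset.sum_nonneg fun i _ => hq i
        have c3 : ∑ i ∈ Finset.range n, q (i + M) = ∑ i ∈ Finset.range n, q (M + i) :=
          Finset.sum_congr rfl fun i _ => by rw [add_comm]
        push_cast at this
        rw [c3]; linarith
      have c4 := hK n
      nlinarith
    have b2 : |(∑ i ∈ Finset.range n, x (i + M)) / (n : ℝ) -
        (∑ i ∈ Finset.range n, y i) / (n : ℝ)| ≤ δ * (4 * K) := by
      rw [← sub_div, abs_div, abs_of_pos hn0, div_le_iff₀ hn0]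
      linarith
    have b3 := abs_sub_le ((∑ i ∈ Finset.range n, x (i + M)) / (n : ℝ))
      ((∑ i ∈ Finset.range n, y i) / (n : ℝ)) l
    have b4 := abs_sub_le ((∑ i ∈ Finset.range n, y i) / (n : ℝ)) l' l
    nlinarith
  have hbig : ∀ᶠ n : ℕ in atTop,
      8 / η * (|∑ i ∈ Finset.range M, x i| + |l| * M) < (n : ℝ) :=
    tendsto_natCast_atTop_atTop.eventually_gt_atTop _
  obtain ⟨N, hN⟩ := eventually_atTop.1 (hclose.and (hbig.and (eventually_gt_atTop 0)))
  refine ⟨N + M, fun m hm => ?_⟩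
  obtain ⟨n, rfl⟩ := Nat.exists_eq_add_of_le' (by omega : M ≤ m)
  obtain ⟨c1, c2, c3⟩ := hN n (by omega)
  have hn0 : (0 : ℝ) < n := by exact_mod_cast c3
  have hnM : (0 : ℝ) < ((n + M : ℕ) : ℝ) := by exact_mod_cast (by omega : 0 < n + M)
  have hsplit : ∑ i ∈ Finset.range (n + M), x i =
      ∑ i ∈ Finset.range M, x i + ∑ i ∈ Finset.range n, x (i + M) := by
    rw [add_comm n M, Finset.sum_range_add]
    exact congrArg _ (Finset.sum_congr rfl fun i _ => by rw [add_comm])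
  rw [Real.dist_eq, hsplit, div_sub' hnM.ne', abs_div, abs_of_pos hnM, div_lt_iff₀ hnM]
  rw [div_sub' hn0.ne', abs_div, abs_of_pos hn0, div_le_iff₀ hn0] at c1
  have c2' : |∑ i ∈ Finset.range M, x i| + |l| * M < η / 8 * n := by
    have := mul_lt_mul_of_pos_left c2 (by positivity : 0 < η / 8)
    have e : η / 8 * (8 / η * (|∑ i ∈ Finset.range M, x i| + |l| * M)) =
        |∑ i ∈ Finset.range M, x i| + |l| * M := by field_simp
    linarith
  have e : ∑ i ∈ Finset.range M, x i + ∑ i ∈ Finset.range n, x (i + M) -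
      ((n + M : ℕ) : ℝ) * l = (∑ i ∈ Finset.range M, x i) +
        (∑ i ∈ Finset.range n, x (i + M) - n * l) - M * l := by push_cast; ring
  rw [e]
  have d1 := abs_sub ((∑ i ∈ Finset.range M, x i) +
        (∑ i ∈ Finset.range n, x (i + M) - n * l)) (M * l)
  have d2 := abs_add_le (∑ i ∈ Finset.range M, x i) (∑ i ∈ Finset.range n, x (i + M) - n * l)
  have d3 : |(M : ℝ) * l| = |l| * M := by rw [abs_mul, Nat.abs_cast, mul_comm]
  push_cast
  have : 0 ≤ η * M := by positivity
  linarith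

/-- The bound behind the stability of the recursion `z (t+1) = a * z t + e t` for `|a| < 1`. -/
theorem sum_sq_le_of_recursion {a : ℝ} (ha : |a| < 1) {z e : ℕ → ℝ}
    (hz : ∀ t, z (t + 1) = a * z t + e t) (n : ℕ) :
    (1 - |a|) * ∑ t ∈ Finset.range n, z t ^ 2 + z n ^ 2 ≤
      z 0 ^ 2 + (∑ t ∈ Finset.range n, e t ^ 2) / (1 - |a|) := by
  have hb : 0 < 1 - |a| := by linarith
  induction n with
  | zero => simp
  | succ n ih =>
    rw [Finset.sum_range_succ, Finset.sum_range_succ, add_div]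
    have key : z (n + 1) ^ 2 ≤ |a| * z n ^ 2 + e n ^ 2 / (1 - |a|) := by
      rw [hz, ← sub_nonneg]
      have h1 : (a * z n + e n) ^ 2 ≤ (|a| * |z n| + |e n|) ^ 2 := by
        rw [← abs_mul]
        exact sq_le_sq' (by linarith [neg_abs_le (a * z n + e n), abs_add_le (a * z n) (e n)])
          ((le_abs_self _).trans (abs_add_le _ _))
      have h2 : |a| * |z n| ^ 2 + |e n| ^ 2 / (1 - |a|) - (|a| * |z n| + |e n|) ^ 2 =
          |a| / (1 - |a|) * ((1 - |a|) * |z n| - |e n|) ^ 2 := by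
        field_simp; ring
      have h3 : 0 ≤ |a| / (1 - |a|) * ((1 - |a|) * |z n| - |e n|) ^ 2 := by positivity
      rw [← h2, sq_abs, sq_abs] at h3
      linarith
    nlinarith

/-- A sum along an arithmetic progression of a nonnegative sequence is at most the full sum. -/
theorem sum_stride_le {z : ℕ → ℝ} (hz : ∀ t, 0 ≤ z t) {p : ℕ} (hp : 0 < p) (q n : ℕ) :
    ∑ i ∈ Finset.range n, z (p * i + q) ≤ ∑ t ∈ Finset.range (p * n + q), z t := by
  have hinj : Set.InjOn (fun i => p * i + q) (Finset.range n : Set ℕ) := by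
    intro i _ j _ hij
    simpa [hp.ne'] using hij
  rw [← Finset.sum_image (f := z) hinj]
  refine Finset.sum_le_sum_of_subset_of_nonneg ?_ fun t _ _ => hz t
  intro t ht
  obtain ⟨i, hi, rfl⟩ := Finset.mem_image.1 ht
  have hi' := Finset.mem_range.1 hi
  have := Nat.mul_lt_mul_of_pos_left hi' hp
  exact Finset.mem_range.2 (by omega)

/-! ### The law of large numbers for moving windows of independent variables -/

section Blocks

variable {Ω : Type*} [MeasurableSpace Ω] {P : Measure Ω}

/-- Functions of disjoint windows of a sequence of independent variables are independent. -/
theorem indepFun_of_disjoint_windows {η : ℕ → Ω → ℝ} (hm : ∀ t, Measurable (η t))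
    (hi : iIndepFun η P) {h : (ℕ → ℝ) → ℝ} (hh : Measurable h) {L : ℕ}
    (hL : ∀ e e' : ℕ → ℝ, (∀ s < L, e s = e' s) → h e = h e') {s t : ℕ}
    (hst : s + L ≤ t ∨ t + L ≤ s) :
    IndepFun (fun ω => h (fun r => η (s + r) ω)) (fun ω => h (fun r => η (t + r) ω)) P := by
  let ext (s : ℕ) (v : (Finset.Ico s (s + L)) → ℝ) (r : ℕ) : ℝ :=
    if hr : s + r ∈ Finset.Ico s (s + L) then v ⟨s + r, hr⟩ else 0
  have hext : ∀ s, Measurable (ext s) := by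
    intro s
    refine measurable_pi_lambda _ fun r => ?_
    by_cases hr : s + r ∈ Finset.Ico s (s + L)
    · simpa only [ext, dif_pos hr] using measurable_pi_apply _
    · simp only [ext, dif_neg hr, measurable_const]
  have hdis : Disjoint (Finset.Ico s (s + L)) (Finset.Ico t (t + L)) := by
    rw [Finset.disjoint_left]
    intro x hx hx'
    rw [Finset.mem_Ico] at hx hx'
    omega
  have hind := (hi.indepFun_finset _ _ hdis hm).comp (hh.comp (hext s)) (hh.comp (hext t))
  have heq : ∀ s, ((h ∘ ext s) ∘ fun ω (i : Finset.Ico s (s + L)) => η i ω) =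
      fun ω => h (fun r => η (s + r) ω) := by
    intro s
    funext ω
    refine hL _ _ fun r hr => ?_
    have hmem : s + r ∈ Finset.Ico s (s + L) := Finset.mem_Ico.2 (by omega)
    simp only [ext, dif_pos hmem]
  rwa [heq, heq] at hind

/-- All windows of an i.i.d. sequence have the same law. -/
theorem identDistrib_window {η : ℕ → Ω → ℝ} (hi : iIndepFun η P)
    (hid : ∀ t, IdentDistrib (η t) (η 0) P P) (s t : ℕ) :
    IdentDistrib (fun ω r => η (s + r) ω) (fun ω r => η (t + r) ω) P P :=
  IdentDistrib.pi (fun r => (hid (s + r)).trans (hid (t + r)).symm)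
    (hi.precomp (add_right_injective s)) (hi.precomp (add_right_injective t))

/-- The strong law of large numbers for a function of finitely many coordinates, evaluated along
windows of an i.i.d. sequence whose starting points form an arithmetic progression. -/
theorem strong_law_windows {η : ℕ → Ω → ℝ} (hm : ∀ t, Measurable (η t)) (hi : iIndepFun η P)
    (hid : ∀ t, IdentDistrib (η t) (η 0) P P) {h : (ℕ → ℝ) → ℝ} (hh : Measurable h) {L : ℕ}
    (hL : ∀ e e' : ℕ → ℝ, (∀ s < L, e s = e' s) → h e = h e')
    (hint : Integrable (fun ω => h (fun r => η r ω)) P) {p : ℕ} (hp : 0 < p) (q : ℕ) :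
    ∀ᵐ ω ∂P, Tendsto (fun n : ℕ =>
      (∑ i ∈ Finset.range n, h (fun r => η (p * i + q + r) ω)) / (n : ℝ)) atTop
      (𝓝 (∫ ω, h (fun r => η r ω) ∂P)) := by
  have hident : ∀ s t : ℕ, IdentDistrib (fun ω => h (fun r => η (s + r) ω))
      (fun ω => h (fun r => η (t + r) ω)) P P := fun s t => (identDistrib_window hi hid s t).comp hh
  have hident0 : ∀ s : ℕ, IdentDistrib (fun ω => h (fun r => η (s + r) ω))
      (fun ω => h (fun r => η r ω)) P P := fun s => by simpa using hident s 0
  have key : ∀ r : ℕ, ∀ᵐ ω ∂P, Tendsto (fun n : ℕ =>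
      (∑ k ∈ Finset.range n, h (fun j => η (p * (k * (L + 1) + r) + q + j) ω)) / (n : ℝ)) atTop
      (𝓝 (∫ ω, h (fun r => η r ω) ∂P)) := by
    intro r
    have := strong_law_ae_real (μ := P)
      (fun k ω => h (fun j => η (p * (k * (L + 1) + r) + q + j) ω))
      ((hident0 _).integrable_iff.2 hint) ?_ fun i => hident _ _
    · rwa [(hident0 _).integral_eq] at this
    · intro k k' hk
      refine indepFun_of_disjoint_windows hm hi hh hL ?_
      have aux : ∀ k k' : ℕ, k < k' →
          p * (k * (L + 1) + r) + q + L ≤ p * (k' * (L + 1) + r) + q := by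
        intro k k' hk
        have h1 : k * (L + 1) + r + (L + 1) ≤ k' * (L + 1) + r := by nlinarith
        have h2 := Nat.mul_le_mul_left p h1
        have h3 : L + 1 ≤ p * (L + 1) := Nat.le_mul_of_pos_left _ hp
        rw [mul_add p _ (L + 1)] at h2
        omega
      rcases lt_or_gt_of_ne hk with h | h
      · exact Or.inl (aux _ _ h)
      · exact Or.inr (aux _ _ h)
  filter_upwards [ae_all_iff.2 key] with ω hω
  exact tendsto_average_of_residues (Nat.succ_pos L) fun r _ => hω r

end Blocks

/-! ### The law of large numbers for stable AR(1) processes -/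

/-- A strictly stationary solution `Z` with finite second moments of `Z (t+1) = a * Z t + η t`,
where `|a| < 1` and the `η t` are i.i.d. -/
structure IsStableAR1 {Ω : Type*} [MeasurableSpace Ω] (P : Measure Ω) (Z η : ℕ → Ω → ℝ) (a : ℝ) :
    Prop where
  abs_lt_one : |a| < 1
  measurable : ∀ t, Measurable (Z t)
  measurable_innovation : ∀ t, Measurable (η t)
  innovation_indep : iIndepFun η P
  innovation_ident : ∀ t, IdentDistrib (η t) (η 0) P P
  recursion : ∀ᵐ ω ∂P, ∀ t, Z (t + 1) ω = a * Z t ω + η t ω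
  stationary : ∀ h : ℕ, IdentDistrib (fun ω (t : ℕ) => Z (t + h) ω) (fun ω (t : ℕ) => Z t ω) P P
  memLp : MemLp (Z 0) 2 P

/-- The value after `m` steps of the recursion `z (t+1) = a * z t + e t` started at `0`. -/
def arFromZero (a : ℝ) : ℕ → (ℕ → ℝ) → ℝ
  | 0, _ => 0
  | m + 1, e => a * arFromZero a m e + e m

theorem arFromZero_congr (a : ℝ) {m : ℕ} {e e' : ℕ → ℝ} (h : ∀ s < m, e s = e' s) :
    arFromZero a m e = arFromZero a m e' := by
  induction m with
  | zero => rfl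
  | succ m ih =>
    simp only [arFromZero]
    rw [ih fun s hs => h s (by omega), h m (by omega)]

theorem measurable_arFromZero (a : ℝ) (m : ℕ) : Measurable (arFromZero a m) := by
  induction m with
  | zero => exact measurable_const
  | succ m ih => exact (ih.const_mul a).add (measurable_pi_apply m)

theorem eq_pow_mul_add_arFromZero {a : ℝ} {z e : ℕ → ℝ} (hz : ∀ t, z (t + 1) = a * z t + e t)
    (t m : ℕ) : z (t + m) = a ^ m * z t + arFromZero a m (fun s => e (t + s)) := by
  induction m with
  | zero => simp [arFromZero]
  | succ m ih =>
    rw [← add_assoc, hz, ih, arFromZero]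
    ring

theorem norm_sq_le_sum_sq {d : ℕ} (u : Fin d → ℝ) : ‖u‖ ^ 2 ≤ ∑ j, u j ^ 2 := by
  have h0 : 0 ≤ ∑ j, u j ^ 2 := Finset.sum_nonneg fun j _ => sq_nonneg _
  rw [← Real.le_sqrt (norm_nonneg _) h0, pi_norm_le_iff_of_nonneg (Real.sqrt_nonneg _)]
  intro j
  refine Real.le_sqrt_of_sq_le ?_
  rw [Real.norm_eq_abs, sq_abs]
  exact Finset.single_le_sum (f := fun j => u j ^ 2) (fun j _ => sq_nonneg _) (Finset.mem_univ j)

/-- `g` is locally Lipschitz with a constant of linear growth. -/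
def IsQuadraticGrowth {d : ℕ} (g : (Fin d → ℝ) → ℝ) (C : ℝ) : Prop :=
  ∀ u w : Fin d → ℝ, |g u - g w| ≤ C * ‖u - w‖ * (‖u‖ + ‖w‖)

namespace IsQuadraticGrowth

variable {d : ℕ} {g : (Fin d → ℝ) → ℝ} {C : ℝ}

theorem continuous (hg : IsQuadraticGrowth g C) : Continuous g := by
  rw [continuous_iff_continuousAt]
  intro w
  rw [ContinuousAt, tendsto_iff_dist_tendsto_zero]
  have hlim : Tendsto (fun u : Fin d → ℝ => C * ‖u - w‖ * (‖u‖ + ‖w‖)) (𝓝 w) (𝓝 0) := by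
    have : Continuous fun u : Fin d → ℝ => C * ‖u - w‖ * (‖u‖ + ‖w‖) := by fun_prop
    simpa using this.tendsto w
  exact squeeze_zero (fun _ => dist_nonneg) (fun u => hg u w) hlim

theorem abs_le (hg : IsQuadraticGrowth g C) (u : Fin d → ℝ) : |g u| ≤ |g 0| + C * ‖u‖ ^ 2 := by
  have h1 := hg u 0
  have h2 := abs_sub_abs_le_abs_sub (g u) (g 0)
  simp only [sub_zero, norm_zero, add_zero] at h1
  nlinarith

/-- The increment between `u` and `u - c • v` for small `c`. -/
theorem abs_sub_sub_smul_le (hg : IsQuadraticGrowth g C) (hC : 0 ≤ C) {c : ℝ} (hc : |c| ≤ 1)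
    (u v : Fin d → ℝ) : |g u - g (u - c • v)| ≤ 2 * C * |c| * (‖u‖ ^ 2 + ‖v‖ ^ 2) := by
  refine (hg u (u - c • v)).trans ?_
  rw [sub_sub_cancel, norm_smul, Real.norm_eq_abs]
  have h1 : ‖u - c • v‖ ≤ ‖u‖ + ‖v‖ := by
    refine (norm_sub_le _ _).trans ?_
    rw [norm_smul, Real.norm_eq_abs]
    nlinarith [norm_nonneg v]
  have h2 : ‖v‖ * (‖u‖ + ‖u - c • v‖) ≤ 2 * (‖u‖ ^ 2 + ‖v‖ ^ 2) := by
    nlinarith [norm_nonneg v, norm_nonneg u, sq_nonneg (‖u‖ - ‖v‖), sq_nonneg (‖u‖)]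
  have h3 : 0 ≤ C * |c| := by positivity
  calc C * (|c| * ‖v‖) * (‖u‖ + ‖u - c • v‖) = C * |c| * (‖v‖ * (‖u‖ + ‖u - c • v‖)) := by ring
    _ ≤ C * |c| * (2 * (‖u‖ ^ 2 + ‖v‖ ^ 2)) := mul_le_mul_of_nonneg_left h2 h3
    _ = _ := by ring

end IsQuadraticGrowth

namespace IsStableAR1

variable {Ω : Type*} [MeasurableSpace Ω] {P : Measure Ω} {Z η : ℕ → Ω → ℝ} {a : ℝ}

theorem identDistrib_window (hZ : IsStableAR1 P Z η a) (d h : ℕ) :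
    IdentDistrib (fun ω (j : Fin d) => Z (h + j) ω) (fun ω (j : Fin d) => Z j ω) P P := by
  have := (hZ.stationary h).comp
    (u := fun (z : ℕ → ℝ) (j : Fin d) => z j) (by fun_prop)
  simpa only [Function.comp_def, add_comm h] using this

theorem memLp_apply (hZ : IsStableAR1 P Z η a) (t : ℕ) : MemLp (Z t) 2 P := by
  have := (hZ.stationary t).comp (u := fun (z : ℕ → ℝ) => z 0) (by fun_prop)
  simp only [Function.comp_def, zero_add] at this
  exact this.memLp_iff.2 hZ.memLp

theorem memLp_innovation (hZ : IsStableAR1 P Z η a) (t : ℕ) : MemLp (η t) 2 P := by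
  refine (memLp_congr_ae ?_).1 ((hZ.memLp_apply (t + 1)).sub ((hZ.memLp_apply t).const_mul a))
  filter_upwards [hZ.recursion] with ω hω
  simp [hω t]

theorem integrable_norm_sq_window (hZ : IsStableAR1 P Z η a) (d t : ℕ) :
    Integrable (fun ω => ‖fun j : Fin d => Z (t + j) ω‖ ^ 2) P := by
  have hs : Integrable (fun ω => ∑ j : Fin d, Z (t + j) ω ^ 2) P :=
    integrable_finsetSum _ fun j _ => (hZ.memLp_apply _).integrable_sq
  have hmeas : Measurable fun ω (j : Fin d) => Z (t + j) ω :=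
    measurable_pi_lambda _ fun j => hZ.measurable _
  refine hs.mono' (hmeas.norm.pow_const 2).aestronglyMeasurable (ae_of_all _ fun ω => ?_)
  rw [Real.norm_eq_abs, abs_of_nonneg (sq_nonneg _)]
  exact norm_sq_le_sum_sq _

theorem integrable_comp_window [IsFiniteMeasure P] (hZ : IsStableAR1 P Z η a) {d : ℕ} {g : (Fin d → ℝ) → ℝ} {C : ℝ}
    (hg : IsQuadraticGrowth g C) (t : ℕ) : Integrable (fun ω => g fun j => Z (t + j) ω) P := by
  have hmeas : Measurable fun ω (j : Fin d) => Z (t + j) ω :=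
    measurable_pi_lambda _ fun j => hZ.measurable _
  refine ((integrable_const |g 0|).add ((hZ.integrable_norm_sq_window d t).const_mul C)).mono'
    (hg.continuous.measurable.comp hmeas).aestronglyMeasurable (ae_of_all _ fun ω => ?_)
  exact hg.abs_le _

/-- The averages of the squares of a stable AR(1) process are bounded. -/
theorem ae_exists_sum_sq_le (hZ : IsStableAR1 P Z η a) :
    ∀ᵐ ω ∂P, ∃ K : ℝ, ∀ n : ℕ, ∑ t ∈ Finset.range n, Z t ω ^ 2 ≤ K * ((n : ℝ) + 1) := by
  have hb : 0 < 1 - |a| := by linarith [hZ.abs_lt_one]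
  have hint : Integrable (fun ω => η 0 ω ^ 2) P := (hZ.memLp_innovation 0).integrable_sq
  have hlln := strong_law_windows hZ.measurable_innovation hZ.innovation_indep
    hZ.innovation_ident (h := fun e => e 0 ^ 2) (by fun_prop) (L := 1)
    (fun e e' h => by simp only [h 0 one_pos]) hint one_pos 0
  filter_upwards [hlln, hZ.recursion] with ω hω hrec
  obtain ⟨B, hB⟩ := hω.bddAbove_range
  have hB' : ∀ n : ℕ, ∑ i ∈ Finset.range n, η i ω ^ 2 ≤ B * n := by
    intro n
    have h1 := hB (Set.mem_range_self n)
    simp only [one_mul, add_zero] at h1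
    rcases Nat.eq_zero_or_pos n with rfl | hn
    · simp
    · rwa [div_le_iff₀ (by exact_mod_cast hn)] at h1
  refine ⟨(Z 0 ω ^ 2 + |B| / (1 - |a|)) / (1 - |a|), fun n => ?_⟩
  have h1 := sum_sq_le_of_recursion hZ.abs_lt_one (z := fun t => Z t ω) (e := fun t => η t ω)
    hrec n
  have h2 : ∑ i ∈ Finset.range n, η i ω ^ 2 ≤ |B| * ((n : ℝ) + 1) := by
    have := hB' n
    have h3 := mul_le_mul_of_nonneg_right (le_abs_self B) (Nat.cast_nonneg (α := ℝ) n)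
    linarith [abs_nonneg B]
  have h3 := div_le_div_of_nonneg_right h2 hb.le
  rw [div_mul_eq_mul_div, le_div_iff₀ hb, mul_comm]
  have h4 : Z 0 ω ^ 2 ≤ Z 0 ω ^ 2 * ((n : ℝ) + 1) :=
    le_mul_of_one_le_right (sq_nonneg _) (by linarith [Nat.cast_nonneg (α := ℝ) n])
  have h5 : |B| * ((n : ℝ) + 1) / (1 - |a|) = |B| / (1 - |a|) * ((n : ℝ) + 1) := by ring
  have h6 := sq_nonneg (Z n ω)
  rw [add_mul]
  linarith

/-- The law of large numbers for a function of quadratic growth of a window of a stable AR(1)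
process, along an arithmetic progression of times. -/
theorem tendsto_average [IsFiniteMeasure P] (hZ : IsStableAR1 P Z η a) {d : ℕ} {g : (Fin d → ℝ) → ℝ} {C : ℝ}
    (hC : 0 ≤ C) (hg : IsQuadraticGrowth g C) {p : ℕ} (hp : 0 < p) (q : ℕ) :
    ∀ᵐ ω ∂P, Tendsto (fun n : ℕ =>
      (∑ i ∈ Finset.range n, g fun j => Z (p * i + q + j) ω) / (n : ℝ)) atTop
      (𝓝 (∫ ω, (g fun j => Z j ω) ∂P)) := by
  have ha := hZ.abs_lt_one
  -- the window of the process restarted from `0`, as a function of the innovations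
  let Φ (m : ℕ) (e : ℕ → ℝ) (j : Fin d) : ℝ := arFromZero a m fun s => e (j + s)
  have hΦm : ∀ m, Measurable (Φ m) := fun m =>
    measurable_pi_lambda _ fun j => (measurable_arFromZero a m).comp (by fun_prop)
  have hΦ : ∀ᵐ ω ∂P, ∀ t m, Φ m (fun r => η (t + r) ω) =
      (fun j : Fin d => Z (t + m + j) ω) - a ^ m • fun j : Fin d => Z (t + j) ω := by
    filter_upwards [hZ.recursion] with ω hω t m
    funext j
    have := eq_pow_mul_add_arFromZero (z := fun t => Z t ω) (e := fun t => η t ω) hω (t + j) m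
    simp only [Φ, Pi.sub_apply, Pi.smul_apply, smul_eq_mul]
    rw [show t + m + (j : ℕ) = t + j + m by ring, this]
    simp only [add_assoc]
    ring
  have hapow : ∀ m, |a ^ m| ≤ 1 := fun m => by
    rw [abs_pow]; exact pow_le_one₀ (abs_nonneg a) ha.le
  have hdiff : ∀ᵐ ω ∂P, ∀ t m, |(g fun j => Z (t + m + j) ω) - g (Φ m fun r => η (t + r) ω)| ≤
      2 * C * |a ^ m| * (‖fun j : Fin d => Z (t + m + j) ω‖ ^ 2 +
        ‖fun j : Fin d => Z (t + j) ω‖ ^ 2) := by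
    filter_upwards [hΦ] with ω hω t m
    rw [hω t m]
    exact hg.abs_sub_sub_smul_le hC (hapow m) _ _
  have hgm : ∀ m, Measurable fun e => g (Φ m e) := fun m => hg.continuous.measurable.comp (hΦm m)
  have hmeasη : Measurable fun ω r => η r ω :=
    measurable_pi_lambda _ fun r => hZ.measurable_innovation r
  have hbound : ∀ m, Integrable (fun ω => 2 * C * |a ^ m| *
      (‖fun j : Fin d => Z (0 + m + j) ω‖ ^ 2 + ‖fun j : Fin d => Z (0 + j) ω‖ ^ 2)) P := fun m =>
    ((hZ.integrable_norm_sq_window d _).add (hZ.integrable_norm_sq_window d _)).const_mul _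
  have hintd : ∀ m, Integrable (fun ω => (g fun j => Z (0 + m + j) ω) -
      g (Φ m fun r => η r ω)) P := by
    intro m
    refine (hbound m).mono' (((hZ.integrable_comp_window hg _).aestronglyMeasurable).sub
      ((hgm m).comp hmeasη).aestronglyMeasurable) ?_
    filter_upwards [hdiff] with ω hω
    simpa using hω 0 m
  have hint : ∀ m, Integrable (fun ω => g (Φ m fun r => η r ω)) P := by
    intro m
    refine ((hZ.integrable_comp_window hg (0 + m)).sub (hintd m)).congr (ae_of_all _ fun ω => ?_)
    simp
  have hwin : ∀ t, ∫ ω, ‖fun j : Fin d => Z (t + j) ω‖ ^ 2 ∂P =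
      ∫ ω, ‖fun j : Fin d => Z j ω‖ ^ 2 ∂P := fun t =>
    ((hZ.identDistrib_window d t).comp (u := fun u => ‖u‖ ^ 2) (by fun_prop)).integral_eq
  have hmean : ∀ m, |∫ ω, g (Φ m fun r => η r ω) ∂P - ∫ ω, (g fun j => Z j ω) ∂P| ≤
      4 * C * |a| ^ m * ∫ ω, ‖fun j : Fin d => Z j ω‖ ^ 2 ∂P := by
    intro m
    have e1 : ∫ ω, (g fun j => Z j ω) ∂P = ∫ ω, (g fun j => Z (0 + m + j) ω) ∂P :=
      ((hZ.identDistrib_window d (0 + m)).comp (u := g)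
        hg.continuous.measurable).integral_eq.symm
    rw [e1, abs_sub_comm, ← integral_sub (hZ.integrable_comp_window hg _) (hint m)]
    refine (abs_integral_le_integral_abs).trans ?_
    refine (integral_mono_ae (hintd m).abs (hbound m) ?_).trans ?_
    · filter_upwards [hdiff] with ω hω
      simpa using hω 0 m
    · rw [integral_const_mul, integral_add (hZ.integrable_norm_sq_window d _)
        (hZ.integrable_norm_sq_window d _), hwin, hwin, abs_pow]
      exact le_of_eq (by ring)
  have hlln : ∀ M : ℕ, ∀ᵐ ω ∂P, Tendsto (fun n : ℕ =>
      (∑ i ∈ Finset.range n, g (Φ (p * M) fun r => η (p * i + q + r) ω)) / (n : ℝ)) atTop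
      (𝓝 (∫ ω, g (Φ (p * M) fun r => η r ω) ∂P)) := by
    intro M
    refine strong_law_windows hZ.measurable_innovation hZ.innovation_indep hZ.innovation_ident
      (hgm _) (L := p * M + d) (fun e e' h => ?_) (hint _) hp q
    congr 1
    funext j
    exact arFromZero_congr a fun s hs => h _ (by have := j.2; omega)
  filter_upwards [hdiff, ae_all_iff.2 hlln, hZ.ae_exists_sum_sq_le] with ω hd hl ⟨K, hK⟩
  have hK0 : 0 ≤ K := by simpa using hK 0
  refine tendsto_average_of_approx
    (q := fun i => ‖fun j : Fin d => Z (p * i + q + j) ω‖ ^ 2)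
    (K := ∑ j : Fin d, K * (p + (q + j) + 1)) (fun i => sq_nonneg _) (fun n => ?_) ?_
  · refine (Finset.sum_le_sum fun i _ => norm_sq_le_sum_sq _).trans ?_
    rw [Finset.sum_comm, Finset.sum_mul]
    refine Finset.sum_le_sum fun j _ => ?_
    have h1 := sum_stride_le (z := fun t => Z t ω ^ 2) (fun t => sq_nonneg _) hp (q + j) n
    have h2 := hK (p * n + (q + j))
    simp only [← add_assoc] at h1 h2
    refine h1.trans (h2.trans ?_)
    push_cast
    rw [mul_assoc]
    refine mul_le_mul_of_nonneg_left ?_ hK0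
    have hn : (0 : ℝ) ≤ n := Nat.cast_nonneg n
    have hq : (0 : ℝ) ≤ q := Nat.cast_nonneg q
    have hj : (0 : ℝ) ≤ (j : ℕ) := Nat.cast_nonneg _
    have hp' : (0 : ℝ) ≤ p := Nat.cast_nonneg p
    nlinarith [mul_nonneg hq hn, mul_nonneg hj hn]
  · intro δ hδ
    have hpow : Tendsto (fun M : ℕ => |a| ^ (p * M)) atTop (𝓝 0) := by
      simp_rw [pow_mul]
      exact tendsto_pow_atTop_nhds_zero_of_lt_one (by positivity)
        (pow_lt_one₀ (abs_nonneg a) ha hp.ne')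
    have l1 : Tendsto (fun M : ℕ => 4 * C * |a| ^ (p * M) *
        ∫ ω, ‖fun j : Fin d => Z j ω‖ ^ 2 ∂P) atTop (𝓝 0) := by
      simpa using (hpow.const_mul (4 * C)).mul_const (∫ ω, ‖fun j : Fin d => Z j ω‖ ^ 2 ∂P)
    have l2 : Tendsto (fun M : ℕ => 2 * C * |a| ^ (p * M)) atTop (𝓝 0) := by
      simpa using hpow.const_mul (2 * C)
    obtain ⟨M, hM1, hM2⟩ := ((l1.eventually (ge_mem_nhds hδ)).and
      (l2.eventually (ge_mem_nhds hδ))).exists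
    refine ⟨M, _, _, (hmean (p * M)).trans hM1, fun i => ?_, hl M⟩
    have := hd (p * i + q) (p * M)
    have e : p * (i + M) + q = p * i + q + p * M := by ring
    rw [e]
    refine this.trans ?_
    rw [abs_pow]
    exact mul_le_mul_of_nonneg_right hM2 (by positivity)

end IsStableAR1

/-! ### More on averages -/

theorem tendsto_average_shift {y : ℕ → ℝ} {l : ℝ} (M : ℕ)
    (h : Tendsto (fun n : ℕ => (∑ i ∈ Finset.range n, y i) / (n : ℝ)) atTop (𝓝 l)) :
    Tendsto (fun n : ℕ => (∑ i ∈ Finset.range n, y (i + M)) / (n : ℝ)) atTop (𝓝 l) := by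
  have h1 : Tendsto (fun n : ℕ => (∑ i ∈ Finset.range M, y i) / (n : ℝ)) atTop (𝓝 0) :=
    tendsto_const_div_atTop_nhds_zero_nat _
  have h2 : Tendsto (fun n : ℕ => 1 + (M : ℝ) / (n : ℝ)) atTop (𝓝 1) := by
    simpa using (tendsto_const_nhds (x := (1 : ℝ))).add
      (tendsto_const_div_atTop_nhds_zero_nat (M : ℝ))
  have h3 := ((h.comp (tendsto_add_atTop_nat M)).mul h2).sub h1
  simp only [mul_one, sub_zero] at h3
  refine h3.congr' ?_
  filter_upwards [eventually_gt_atTop 0] with n hn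
  have hn' : (0 : ℝ) < n := by exact_mod_cast hn
  have hnM : (0 : ℝ) < n + M := by positivity
  have hsplit : ∑ i ∈ Finset.range (n + M), y i =
      ∑ i ∈ Finset.range M, y i + ∑ i ∈ Finset.range n, y (i + M) := by
    rw [add_comm n M, Finset.sum_range_add]
    exact congrArg _ (Finset.sum_congr rfl fun i _ => by rw [add_comm])
  simp only [Function.comp_apply]
  rw [hsplit]
  push_cast
  field_simp
  ring

/-- Averages are not affected by errors with vanishing weights. -/
theorem tendsto_average_of_vanishing_error {x y q δ : ℕ → ℝ} {l K : ℝ} (hq : ∀ i, 0 ≤ q i)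
    (hK : ∀ n : ℕ, ∑ i ∈ Finset.range n, q i ≤ K * ((n : ℝ) + 1))
    (hδ : Tendsto δ atTop (𝓝 0)) (hxy : ∀ᶠ i in atTop, |x i - y i| ≤ δ i * q i)
    (hy : Tendsto (fun n : ℕ => (∑ i ∈ Finset.range n, y i) / (n : ℝ)) atTop (𝓝 l)) :
    Tendsto (fun n : ℕ => (∑ i ∈ Finset.range n, x i) / (n : ℝ)) atTop (𝓝 l) := by
  refine tendsto_average_of_approx hq hK fun ρ hρ => ?_
  obtain ⟨M, hM⟩ := eventually_atTop.1 (hxy.and (hδ.eventually (ge_mem_nhds hρ)))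
  refine ⟨M, fun i => y (i + M), l, by simpa using hρ.le, fun i => ?_, tendsto_average_shift M hy⟩
  obtain ⟨h1, h2⟩ := hM (i + M) (by omega)
  refine h1.trans ((mul_le_mul_of_nonneg_right h2 (hq _)).trans ?_)
  exact mul_le_mul_of_nonneg_left (by linarith [hq i]) hρ.le

/-! ### Functions of quadratic growth -/

namespace IsQuadraticGrowth

variable {d : ℕ} {g g' : (Fin d → ℝ) → ℝ} {C C' : ℝ}

theorem coord_mul_coord (i j : Fin d) : IsQuadraticGrowth (fun u => u i * u j) 1 := by
  intro u w
  have e : u i * u j - w i * w j = u i * (u j - w j) + (u i - w i) * w j := by ring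
  have h1 : |u i| ≤ ‖u‖ := norm_le_pi_norm u i
  have h2 : |w j| ≤ ‖w‖ := norm_le_pi_norm w j
  have h3 : |u j - w j| ≤ ‖u - w‖ := norm_le_pi_norm (u - w) j
  have h4 : |u i - w i| ≤ ‖u - w‖ := norm_le_pi_norm (u - w) i
  calc |u i * u j - w i * w j| ≤ |u i| * |u j - w j| + |u i - w i| * |w j| := by
        rw [e, ← abs_mul, ← abs_mul]; exact abs_add_le _ _
    _ ≤ ‖u‖ * ‖u - w‖ + ‖u - w‖ * ‖w‖ := by gcongr
    _ = 1 * ‖u - w‖ * (‖u‖ + ‖w‖) := by ring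

theorem add (hg : IsQuadraticGrowth g C) (hg' : IsQuadraticGrowth g' C') :
    IsQuadraticGrowth (fun u => g u + g' u) (C + C') := by
  intro u w
  have e : g u + g' u - (g w + g' w) = (g u - g w) + (g' u - g' w) := by ring
  rw [e]
  refine (abs_add_le _ _).trans ((add_le_add (hg u w) (hg' u w)).trans (le_of_eq (by ring)))

theorem const_mul (hg : IsQuadraticGrowth g C) (c : ℝ) :
    IsQuadraticGrowth (fun u => c * g u) (|c| * C) := by
  intro u w
  rw [← mul_sub, abs_mul]
  exact (mul_le_mul_of_nonneg_left (hg u w) (abs_nonneg c)).trans (le_of_eq (by ring))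

theorem comp (hg : IsQuadraticGrowth g C) {φ : ℝ → ℝ} (hφ : ∀ s t, |φ s - φ t| ≤ |s - t|) :
    IsQuadraticGrowth (fun u => φ (g u)) C :=
  fun u w => (hφ _ _).trans (hg u w)

end IsQuadraticGrowth

/-! ### The betting score -/

/-- The logarithm of the score whose likelihood ratio is `exp s`. -/
noncomputable def logScore (s : ℝ) : ℝ := Real.log 2 - Real.log (1 + Real.exp s)

theorem logScore_sub_le (s t : ℝ) : logScore s - logScore t ≤ |s - t| := by
  have h1 : 1 + Real.exp t ≤ Real.exp |s - t| * (1 + Real.exp s) := by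
    have h2 : 1 ≤ Real.exp |s - t| := Real.one_le_exp (abs_nonneg _)
    have h3 : Real.exp t ≤ Real.exp |s - t| * Real.exp s := by
      rw [← Real.exp_add]
      exact Real.exp_le_exp.2 (by linarith [neg_abs_le (s - t)])
    linarith
  have h4 := Real.log_le_log (by positivity) h1
  rw [Real.log_mul (Real.exp_pos _).ne' (by positivity), Real.log_exp] at h4
  unfold logScore
  linarith

theorem abs_logScore_sub_le (s t : ℝ) : |logScore s - logScore t| ≤ |s - t| := by
  rw [abs_le]
  refine ⟨?_, logScore_sub_le s t⟩
  have := logScore_sub_le t s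
  rw [abs_sub_comm] at this
  linarith

theorem logScore_zero : logScore 0 = 0 := by
  rw [logScore, Real.exp_zero, one_add_one_eq_two, sub_self]

theorem logScore_eq (s : ℝ) : logScore s = -Real.log ((1 + Real.exp s) / 2) := by
  rw [logScore, Real.log_div (by positivity) (by norm_num)]
  ring

theorem half_one_sub_exp_le_logScore (s : ℝ) : (1 - Real.exp s) / 2 ≤ logScore s := by
  have := Real.log_le_sub_one_of_pos (by positivity : 0 < (1 + Real.exp s) / 2)
  rw [logScore_eq]
  linarith

theorem half_one_sub_exp_lt_logScore {s : ℝ} (hs : s ≠ 0) :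
    (1 - Real.exp s) / 2 < logScore s := by
  have hne : (1 + Real.exp s) / 2 ≠ 1 := by
    intro h
    exact hs ((Real.exp_eq_one_iff s).1 (by linarith))
  have := Real.log_lt_sub_one_of_pos (by positivity : 0 < (1 + Real.exp s) / 2) hne
  rw [logScore_eq]
  linarith

/-- The log-likelihood ratio of the order `(z, y)` against the order `(y, z)`, when
`α = a ^ 2 / (2 * v)` and `β = a / v`. -/
def swapExponent (α β x y z : ℝ) : ℝ := α * (y ^ 2 - z ^ 2) - β * (x * (y - z))

theorem arDensity_swap (a : ℝ) {v : ℝ} (hv : v ≠ 0) (x y z : ℝ) :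
    arDensity a v x z y =
      arDensity a v x y z * Real.exp (swapExponent (a ^ 2 / (2 * v)) (a / v) x y z) := by
  rw [arDensity, arDensity, mul_assoc (1 / (2 * Real.pi * v)), ← Real.exp_add, swapExponent]
  congr 2
  field_simp
  ring

theorem pairScore_eq (a : ℝ) {v : ℝ} (hv : v ≠ 0) (x y z : ℝ) :
    pairScore a v x y z =
      2 / (1 + Real.exp (swapExponent (a ^ 2 / (2 * v)) (a / v) x y z)) := by
  have h0 : arDensity a v x y z ≠ 0 :=
    mul_ne_zero (one_div_ne_zero (mul_ne_zero (by positivity) hv)) (Real.exp_pos _).ne'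
  rw [pairScore, arDensity_swap a hv x y z, ← mul_one_add, mul_comm 2, mul_div_mul_left _ _ h0]

theorem pairScore_pos (a : ℝ) {v : ℝ} (hv : v ≠ 0) (x y z : ℝ) : 0 < pairScore a v x y z := by
  rw [pairScore_eq a hv]
  positivity

theorem log_pairScore (a : ℝ) {v : ℝ} (hv : v ≠ 0) (x y z : ℝ) :
    Real.log (pairScore a v x y z) =
      logScore (swapExponent (a ^ 2 / (2 * v)) (a / v) x y z) := by
  rw [pairScore_eq a hv, Real.log_div two_ne_zero (by positivity), logScore]

theorem abs_swapExponent_sub_le (α β α' β' x y z : ℝ) :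
    |swapExponent α β x y z - swapExponent α' β' x y z| ≤
      (|α - α'| + |β - β'|) * (x ^ 2 + y ^ 2 + z ^ 2) := by
  have e : swapExponent α β x y z - swapExponent α' β' x y z =
      (α - α') * (y ^ 2 - z ^ 2) - (β - β') * (x * (y - z)) := by
    unfold swapExponent; ring
  have h1 : |y ^ 2 - z ^ 2| ≤ x ^ 2 + y ^ 2 + z ^ 2 := by
    rw [abs_le]; constructor <;> nlinarith [sq_nonneg x, sq_nonneg y, sq_nonneg z]
  have h2 : |x * (y - z)| ≤ x ^ 2 + y ^ 2 + z ^ 2 := by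
    rw [abs_le]
    constructor <;> nlinarith [sq_nonneg (x + y), sq_nonneg (x - z), sq_nonneg (x - y),
      sq_nonneg (x + z), sq_nonneg y, sq_nonneg z]
  rw [e, add_mul]
  refine (abs_sub _ _).trans ?_
  rw [abs_mul, abs_mul]
  gcongr

theorem exists_isQuadraticGrowth_logScore (α β : ℝ) : ∃ C, 0 ≤ C ∧
    IsQuadraticGrowth (fun u : Fin 3 → ℝ => logScore (swapExponent α β (u 0) (u 1) (u 2))) C := by
  have h := (((IsQuadraticGrowth.coord_mul_coord (d := 3) 1 1).const_mul α).add
    ((IsQuadraticGrowth.coord_mul_coord 2 2).const_mul (-α))).add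
    (((IsQuadraticGrowth.coord_mul_coord 0 1).const_mul (-β)).add
    ((IsQuadraticGrowth.coord_mul_coord 0 2).const_mul β))
  refine ⟨|α| * 1 + |-α| * 1 + (|-β| * 1 + |β| * 1), by positivity,
    IsQuadraticGrowth.comp (φ := logScore) ?_ abs_logScore_sub_le⟩
  convert h using 2
  unfold swapExponent
  ring

/-! ### Consistency of the least squares estimates -/

theorem lsCoef_succ {Ω : Type*} (X : ℕ → Ω → ℝ) (n : ℕ) (ω : Ω) :
    lsCoef X (n + 1) ω = (∑ t ∈ Finset.range n, X (t + 1) ω * X (t + 2) ω) /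
      ∑ t ∈ Finset.range n, X (t + 1) ω ^ 2 := by
  rw [lsCoef, Finset.range_eq_Ico, ← Finset.Ico_add_one_right_eq_Icc,
    ← Finset.Ico_add_one_right_eq_Icc]
  congr 1
  · rw [Finset.sum_Ico_eq_sum_range, ← Finset.range_eq_Ico]
    refine Finset.sum_congr (by congr 1) fun t _ => ?_
    rw [show 2 + t - 1 = t + 1 by omega, add_comm 2 t, mul_comm]
  · rw [Finset.sum_Ico_eq_sum_range, ← Finset.range_eq_Ico]
    refine Finset.sum_congr (by congr 1) fun t _ => ?_
    rw [add_comm 1 t]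

theorem lsVar_succ {Ω : Type*} (X : ℕ → Ω → ℝ) (n : ℕ) (ω : Ω) :
    lsVar X (n + 1) ω =
      (∑ t ∈ Finset.range n, X (t + 2) ω ^ 2) / n -
        2 * lsCoef X (n + 1) ω * ((∑ t ∈ Finset.range n, X (t + 1) ω * X (t + 2) ω) / n) +
        lsCoef X (n + 1) ω ^ 2 * ((∑ t ∈ Finset.range n, X (t + 1) ω ^ 2) / n) := by
  rw [lsVar]
  have e : ∑ i ∈ Finset.Icc 2 (n + 1), (X i ω - lsCoef X (n + 1) ω * X (i - 1) ω) ^ 2 =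
      ∑ t ∈ Finset.range n, (X (t + 2) ω - lsCoef X (n + 1) ω * X (t + 1) ω) ^ 2 := by
    rw [← Finset.Ico_add_one_right_eq_Icc, Finset.sum_Ico_eq_sum_range]
    refine Finset.sum_congr (by congr 1) fun t _ => ?_
    rw [show 2 + t - 1 = t + 1 by omega, add_comm 2 t]
  have e2 : ∑ t ∈ Finset.range n, (X (t + 2) ω - lsCoef X (n + 1) ω * X (t + 1) ω) ^ 2 =
      ∑ t ∈ Finset.range n, X (t + 2) ω ^ 2 -
        2 * lsCoef X (n + 1) ω * ∑ t ∈ Finset.range n, X (t + 1) ω * X (t + 2) ω +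
        lsCoef X (n + 1) ω ^ 2 * ∑ t ∈ Finset.range n, X (t + 1) ω ^ 2 := by
    rw [Finset.mul_sum, Finset.mul_sum, ← Finset.sum_sub_distrib, ← Finset.sum_add_distrib]
    exact Finset.sum_congr rfl fun t _ => by ring
  rw [e, e2]
  push_cast
  ring

/-- Least squares is consistent for a stable AR(1) process with centred nondegenerate innovations
that are uncorrelated with the past. -/
theorem IsStableAR1.tendsto_leastSquares {Ω : Type*} [MeasurableSpace Ω] {P : Measure Ω}
    [IsProbabilityMeasure P] {X η : ℕ → Ω → ℝ} {a v : ℝ}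
    (hX : IsStableAR1 P (fun t => X (t + 1)) η a) (hv : 0 < v)
    (huncorr : ∫ ω, X 1 ω * η 0 ω ∂P = 0) (hvar : ∫ ω, η 0 ω ^ 2 ∂P = v) :
    ∀ᵐ ω ∂P, Tendsto (fun n => lsCoef X (n + 1) ω) atTop (𝓝 a) ∧
      Tendsto (fun n => lsVar X (n + 1) ω) atTop (𝓝 v) := by
  have ha := hX.abs_lt_one
  have m1 : MemLp (X 1) 2 P := hX.memLp_apply 0
  have m2 : MemLp (X 2) 2 P := hX.memLp_apply 1
  have mη : MemLp (η 0) 2 P := hX.memLp_innovation 0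
  have hrec : ∀ᵐ ω ∂P, X 2 ω = a * X 1 ω + η 0 ω := by
    filter_upwards [hX.recursion] with ω hω using hω 0
  set V := ∫ ω, X 1 ω ^ 2 ∂P with hV
  have i11 : Integrable (fun ω => X 1 ω ^ 2) P := m1.integrable_sq
  have i1η : Integrable (fun ω => X 1 ω * η 0 ω) P := m1.integrable_mul mη
  have iηη : Integrable (fun ω => η 0 ω ^ 2) P := mη.integrable_sq
  have hc : ∫ ω, X 1 ω * X 2 ω ∂P = a * V := by
    have : ∫ ω, X 1 ω * X 2 ω ∂P = ∫ ω, (a * X 1 ω ^ 2 + X 1 ω * η 0 ω) ∂P :=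
      integral_congr_ae (by filter_upwards [hrec] with ω hω; rw [hω]; ring)
    rw [this, integral_add (i11.const_mul a) i1η, integral_const_mul, huncorr, add_zero]
  have hV2 : ∫ ω, X 2 ω ^ 2 ∂P = V := by
    have := ((hX.stationary 1).comp (u := fun z : ℕ → ℝ => z 0 ^ 2) (by fun_prop)).integral_eq
    simpa [Function.comp_def] using this
  have hVv : V = a ^ 2 * V + v := by
    have h1 : ∫ ω, X 2 ω ^ 2 ∂P =
        ∫ ω, (a ^ 2 * X 1 ω ^ 2 + (2 * a * (X 1 ω * η 0 ω) + η 0 ω ^ 2)) ∂P :=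
      integral_congr_ae (by filter_upwards [hrec] with ω hω; rw [hω]; ring)
    have h2 : ∫ ω, (2 * a * (X 1 ω * η 0 ω) + η 0 ω ^ 2) ∂P = v := by
      rw [integral_add (i1η.const_mul _) iηη, integral_const_mul, huncorr, hvar]
      ring
    have i2 : Integrable (fun ω => 2 * a * (X 1 ω * η 0 ω) + η 0 ω ^ 2) P :=
      (i1η.const_mul _).add iηη
    rw [integral_add (i11.const_mul _) i2, h2, integral_const_mul, hV2] at h1
    exact h1
  have hVpos : 0 < V := by
    have h0 : 0 ≤ V := integral_nonneg fun ω => sq_nonneg _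
    have h1 : a ^ 2 < 1 := (sq_lt_one_iff_abs_lt_one a).2 ha
    nlinarith
  have t1 := hX.tendsto_average (d := 2) (zero_le_one)
    (IsQuadraticGrowth.coord_mul_coord 0 0) one_pos 0
  have t2 := hX.tendsto_average (d := 2) (zero_le_one)
    (IsQuadraticGrowth.coord_mul_coord 0 1) one_pos 0
  have t3 := hX.tendsto_average (d := 2) (zero_le_one)
    (IsQuadraticGrowth.coord_mul_coord 1 1) one_pos 0
  simp only [one_mul, add_zero, Fin.val_zero, Fin.val_one, zero_add, ← pow_two, one_add_one_eq_two,
    add_assoc] at t1 t2 t3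
  rw [← hV] at t1
  rw [hc] at t2
  rw [hV2] at t3
  filter_upwards [t1, t2, t3] with ω h1 h2 h3
  have hcoef : Tendsto (fun n => lsCoef X (n + 1) ω) atTop (𝓝 a) := by
    have := h2.div h1 hVpos.ne'
    rw [mul_div_cancel_right₀ _ hVpos.ne'] at this
    refine this.congr' ?_
    filter_upwards [eventually_gt_atTop 0] with n hn
    have hn' : (n : ℝ) ≠ 0 := by exact_mod_cast hn.ne'
    rw [lsCoef_succ, Pi.div_apply, div_div_div_cancel_right₀ hn']
  refine ⟨hcoef, ?_⟩
  have := (h3.sub ((hcoef.const_mul 2).mul h2)).add ((hcoef.pow 2).mul h1)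
  have e : V - 2 * a * (a * V) + a ^ 2 * V = v := by linarith
  rw [e] at this
  exact this.congr fun n => (lsVar_succ X n ω).symm

/-! ### The stationary law of a Gaussian AR(1) process -/

theorem charFun_iterate {ν : Measure ℝ} {a v : ℝ}
    (h : ∀ t, charFun ν t = charFun ν (a * t) * Complex.exp (-(v * t ^ 2 / 2 : ℝ))) (n : ℕ)
    (t : ℝ) : charFun ν t = charFun ν (a ^ n * t) *
      Complex.exp (-(v * t ^ 2 / 2 * ∑ k ∈ Finset.range n, (a ^ 2) ^ k : ℝ)) := by
  induction n with
  | zero => simp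
  | succ n ih =>
    rw [ih, h (a ^ n * t), mul_assoc, ← Complex.exp_add, ← mul_assoc a, ← pow_succ',
      Finset.sum_range_succ]
    congr 2
    push_cast
    ring

/-- A solution of the characteristic function equation of a stationary Gaussian AR(1) process
exists only for `|a| < 1`. -/
theorem abs_lt_one_of_charFun {ν : Measure ℝ} [IsProbabilityMeasure ν] {a v : ℝ} (hv : 0 < v)
    (h : ∀ t, charFun ν t = charFun ν (a * t) * Complex.exp (-(v * t ^ 2 / 2 : ℝ))) :
    |a| < 1 := by
  by_contra! ha
  have hzero : ∀ t : ℝ, t ≠ 0 → charFun ν t = 0 := by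
    intro t ht
    have hle : ∀ n : ℕ, ‖charFun ν t‖ ≤ Real.exp (-(v * t ^ 2 / 2)) ^ n := by
      intro n
      rw [charFun_iterate h n t, norm_mul, ← Complex.ofReal_neg, ← Complex.ofReal_exp,
        Complex.norm_real, Real.norm_eq_abs, Real.abs_exp, ← Real.exp_nat_mul]
      have h1 : (n : ℝ) ≤ ∑ k ∈ Finset.range n, (a ^ 2) ^ k := by
        have : ∑ _k ∈ Finset.range n, (1 : ℝ) ≤ ∑ k ∈ Finset.range n, (a ^ 2) ^ k :=
          Finset.sum_le_sum fun k _ => one_le_pow₀ ((one_le_sq_iff_one_le_abs a).2 ha)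
        simpa using this
      have h2 : 0 ≤ v * t ^ 2 / 2 := by positivity
      calc _ ≤ 1 * Real.exp (-(v * t ^ 2 / 2 * ∑ k ∈ Finset.range n, (a ^ 2) ^ k)) :=
            mul_le_mul_of_nonneg_right (norm_charFun_le_one _) (Real.exp_pos _).le
        _ ≤ _ := by
            rw [one_mul]
            exact Real.exp_le_exp.2 (by nlinarith)
    have hlim : Tendsto (fun n : ℕ => Real.exp (-(v * t ^ 2 / 2)) ^ n) atTop (𝓝 0) := by
      refine tendsto_pow_atTop_nhds_zero_of_lt_one (Real.exp_pos _).le ?_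
      rw [Real.exp_lt_one_iff]
      have : 0 < v * t ^ 2 / 2 := by positivity
      linarith
    exact norm_le_zero_iff.1 (ge_of_tendsto' hlim hle)
  have h1 : Tendsto (charFun ν) (𝓝[≠] 0) (𝓝 1) := by
    have := (continuous_charFun (μ := ν)).tendsto 0
    rw [charFun_zero] at this
    simpa using this.mono_left nhdsWithin_le_nhds
  have h2 : Tendsto (charFun ν) (𝓝[≠] 0) (𝓝 0) :=
    tendsto_const_nhds.congr' (by filter_upwards [self_mem_nhdsWithin] with t ht using
      (hzero t ht).symm)
  exact one_ne_zero (tendsto_nhds_unique h1 h2)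

theorem eq_gaussianReal_of_charFun {ν : Measure ℝ} [IsProbabilityMeasure ν] {a v : ℝ}
    (hv : 0 < v) (ha : |a| < 1)
    (h : ∀ t, charFun ν t = charFun ν (a * t) * Complex.exp (-(v * t ^ 2 / 2 : ℝ))) :
    ν = gaussianReal 0 (v / (1 - a ^ 2)).toNNReal := by
  have ha2 : a ^ 2 < 1 := (sq_lt_one_iff_abs_lt_one a).2 ha
  refine Measure.ext_of_charFun (funext fun t => ?_)
  have hpow : Tendsto (fun n : ℕ => a ^ n * t) atTop (𝓝 0) := by
    simpa using (tendsto_pow_atTop_nhds_zero_of_abs_lt_one ha).mul_const t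
  have h1 : Tendsto (fun n : ℕ => charFun ν (a ^ n * t)) atTop (𝓝 1) := by
    have := (continuous_charFun (μ := ν)).tendsto 0
    rw [charFun_zero] at this
    simpa [Function.comp_def] using this.comp hpow
  have h2 : Tendsto (fun n : ℕ => ∑ k ∈ Finset.range n, (a ^ 2) ^ k) atTop (𝓝 (1 - a ^ 2)⁻¹) :=
    (hasSum_geometric_of_lt_one (sq_nonneg a) ha2).tendsto_sum_nat
  have h3 : Tendsto (fun n : ℕ =>
      Complex.exp (-(v * t ^ 2 / 2 * ∑ k ∈ Finset.range n, (a ^ 2) ^ k : ℝ))) atTop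
      (𝓝 (Complex.exp (-(v * t ^ 2 / 2 * (1 - a ^ 2)⁻¹ : ℝ)))) :=
    (Complex.continuous_exp.tendsto _).comp
      ((Complex.continuous_ofReal.tendsto _).comp (h2.const_mul _)).neg
  have h4 := tendsto_nhds_unique
    (tendsto_const_nhds.congr fun n => charFun_iterate h n t) (h1.mul h3)
  rw [h4, charFun_gaussianReal, one_mul, Real.coe_toNNReal _ (div_nonneg hv.le (by linarith))]
  congr 1
  push_cast
  rw [mul_zero, zero_mul, zero_sub]
  ring

/-! ### The expected logarithm of the score -/

theorem lintegral_gaussianReal_add {v : ℝ≥0} (hv : v ≠ 0) {f : ℝ → ℝ≥0∞} (hf : Measurable f)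
    (c : ℝ) : ∫⁻ e, f (c + e) ∂gaussianReal 0 v = ∫⁻ y, gaussianPDF c v y * f y := by
  rw [gaussianReal_of_var_ne_zero 0 hv,
    lintegral_withDensity_eq_lintegral_mul _ (measurable_gaussianPDF 0 v)
      (g := fun e => f (c + e)) (hf.comp (measurable_const_add c)),
    ← lintegral_add_left_eq_self (fun y => gaussianPDF c v y * f y) c]
  refine lintegral_congr fun e => ?_
  simp only [Pi.mul_apply, gaussianPDF, gaussianPDFReal]
  ring_nf

/-- Exchanging the two observations after the present one amounts to the factor
`exp (swapExponent …)`. -/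
theorem gaussianPDF_mul_swap (a : ℝ) {v : ℝ≥0} (hv : v ≠ 0) (x y z : ℝ) :
    gaussianPDF (a * x) v y * (gaussianPDF (a * y) v z *
      ENNReal.ofReal (Real.exp (swapExponent (a ^ 2 / (2 * v)) (a / v) x y z))) =
      gaussianPDF (a * x) v z * gaussianPDF (a * z) v y := by
  have hv' : (v : ℝ) ≠ 0 := by exact_mod_cast hv
  have hp := fun m t => gaussianPDFReal_nonneg m v t
  simp only [gaussianPDF]
  rw [← ENNReal.ofReal_mul (hp _ _), ← ENNReal.ofReal_mul (hp _ _), ← ENNReal.ofReal_mul (hp _ _)]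
  congr 1
  simp only [gaussianPDFReal, swapExponent]
  have e : ∀ c p q r s : ℝ, p + q + r = s →
      c * Real.exp p * (c * Real.exp q * Real.exp r) = c * c * Real.exp s := by
    intro c p q r s h
    rw [← h, Real.exp_add, Real.exp_add]; ring
  have e' : ∀ c p q s : ℝ, p + q = s → c * Real.exp p * (c * Real.exp q) = c * c * Real.exp s := by
    intro c p q s h
    rw [← h, Real.exp_add]; ring
  rw [e' _ _ _ _ rfl]
  refine e _ _ _ _ _ ?_
  field_simp
  ring

theorem measurable_swapExponent (α β : ℝ) :
    Measurable fun u : ℝ × ℝ × ℝ => swapExponent α β u.1 u.2.1 u.2.2 := by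
  unfold swapExponent
  fun_prop

/-- The present observation and the next two as functions of the present one and the
innovations. -/
def arTriple (a : ℝ) (w : ℝ × ℝ × ℝ) : ℝ × ℝ × ℝ :=
  (w.1, a * w.1 + w.2.1, a * (a * w.1 + w.2.1) + w.2.2)

theorem measurable_arTriple (a : ℝ) : Measurable (arTriple a) := by
  unfold arTriple
  fun_prop

theorem lintegral_lintegral_exchange {v : ℝ≥0} (hv : v ≠ 0) (a x : ℝ) {R : ℝ × ℝ → ℝ≥0∞}
    (hR : Measurable R)
    (hswap : ∀ y z, gaussianPDF (a * x) v y * (gaussianPDF (a * y) v z * R (y, z)) =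
      gaussianPDF (a * x) v z * gaussianPDF (a * z) v y) :
    ∫⁻ e, ∫⁻ e', R (a * x + e, a * (a * x + e) + e') ∂gaussianReal 0 v ∂gaussianReal 0 v = 1 := by
  have hpdf : Measurable fun u : ℝ × ℝ => gaussianPDF (a * u.1) v u.2 := by
    unfold gaussianPDF gaussianPDFReal; fun_prop
  have hjoint : Measurable fun u : ℝ × ℝ => gaussianPDF (a * u.1) v u.2 * R u := hpdf.mul hR
  have hin : ∀ y : ℝ, ∫⁻ e, R (y, a * y + e) ∂gaussianReal 0 v =
      ∫⁻ z, gaussianPDF (a * y) v z * R (y, z) := fun y =>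
    lintegral_gaussianReal_add hv (hR.comp measurable_prodMk_left) (a * y)
  have hpull : ∀ y : ℝ, gaussianPDF (a * x) v y * ∫⁻ z, gaussianPDF (a * y) v z * R (y, z) =
      ∫⁻ z, gaussianPDF (a * x) v z * gaussianPDF (a * z) v y := by
    intro y
    have hy : Measurable fun z => gaussianPDF (a * y) v z * R (y, z) :=
      (measurable_gaussianPDF _ v).mul (hR.comp measurable_prodMk_left)
    rw [← lintegral_const_mul _ hy]
    exact lintegral_congr fun z => hswap y z
  have hone : ∀ m : ℝ, ∫⁻ y, gaussianPDF m v y = 1 := fun m => lintegral_gaussianPDF_eq_one m hv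
  simp_rw [hin]
  rw [lintegral_gaussianReal_add hv (f := fun y => ∫⁻ z, gaussianPDF (a * y) v z * R (y, z))
    hjoint.lintegral_prod_right', lintegral_congr hpull,
    lintegral_lintegral_swap (((measurable_gaussianPDF (a * x) v).comp measurable_snd).mul
      (hpdf.comp measurable_swap)).aemeasurable]
  simp_rw [lintegral_const_mul _ (measurable_gaussianPDF _ v), hone, mul_one, hone]

/-- The likelihood ratio of the exchanged order has mean one. -/
theorem lintegral_exp_swapExponent (ν : Measure ℝ) [IsProbabilityMeasure ν] (a : ℝ) {v : ℝ≥0}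
    (hv : v ≠ 0) :
    ∫⁻ w, ENNReal.ofReal (Real.exp (swapExponent (a ^ 2 / (2 * v)) (a / v) (arTriple a w).1
      (arTriple a w).2.1 (arTriple a w).2.2))
      ∂(ν.prod ((gaussianReal 0 v).prod (gaussianReal 0 v))) = 1 := by
  have hD : Measurable fun u : ℝ × ℝ × ℝ => ENNReal.ofReal
      (Real.exp (swapExponent (a ^ 2 / (2 * v)) (a / v) u.1 u.2.1 u.2.2)) :=
    (measurable_swapExponent _ _).exp.ennreal_ofReal
  have hT : Measurable fun w : ℝ × ℝ × ℝ => ENNReal.ofReal (Real.exp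
      (swapExponent (a ^ 2 / (2 * v)) (a / v) (arTriple a w).1 (arTriple a w).2.1
        (arTriple a w).2.2)) := hD.comp (measurable_arTriple a)
  rw [lintegral_prod _ hT.aemeasurable]
  have key : ∀ x : ℝ, ∫⁻ w : ℝ × ℝ, ENNReal.ofReal (Real.exp (swapExponent (a ^ 2 / (2 * v))
      (a / v) (arTriple a (x, w)).1 (arTriple a (x, w)).2.1 (arTriple a (x, w)).2.2))
      ∂((gaussianReal 0 v).prod (gaussianReal 0 v)) = 1 := by
    intro x
    have hTx : Measurable fun w : ℝ × ℝ => ENNReal.ofReal (Real.exp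
        (swapExponent (a ^ 2 / (2 * v)) (a / v) (arTriple a (x, w)).1 (arTriple a (x, w)).2.1
          (arTriple a (x, w)).2.2)) := hT.comp measurable_prodMk_left
    rw [lintegral_prod _ hTx.aemeasurable]
    exact lintegral_lintegral_exchange hv a x (hD.comp (measurable_prodMk_left (x := x)))
      fun y z => gaussianPDF_mul_swap a hv x y z
  rw [lintegral_congr key]
  simp

/-- The likelihood ratio of the exchanged order is almost surely different from one. -/
theorem ae_swapExponent_ne_zero (ν : Measure ℝ) [IsProbabilityMeasure ν] {a : ℝ} (ha : a ≠ 0)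
    {v : ℝ≥0} (hv : v ≠ 0) :
    ∀ᵐ w ∂(ν.prod ((gaussianReal 0 v).prod (gaussianReal 0 v))),
      swapExponent (a ^ 2 / (2 * v)) (a / v) (arTriple a w).1 (arTriple a w).2.1
        (arTriple a w).2.2 ≠ 0 := by
  have hv' : (v : ℝ) ≠ 0 := by exact_mod_cast hv
  have hs : MeasurableSet {w : ℝ × ℝ × ℝ | swapExponent (a ^ 2 / (2 * v)) (a / v)
      (arTriple a w).1 (arTriple a w).2.1 (arTriple a w).2.2 ≠ 0} :=
    (((measurable_swapExponent _ _).comp (measurable_arTriple a)) (measurableSet_singleton 0)).compl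
  rw [Measure.ae_prod_iff_ae_ae hs]
  refine ae_of_all _ fun x => ?_
  rw [Measure.ae_prod_iff_ae_ae (p := fun w : ℝ × ℝ => swapExponent (a ^ 2 / (2 * v)) (a / v)
    (arTriple a (x, w)).1 (arTriple a (x, w)).2.1 (arTriple a (x, w)).2.2 ≠ 0)
    (hs.preimage measurable_prodMk_left)]
  refine ae_of_all _ fun e => ?_
  have := nullSingletonClass_gaussianReal (μ := 0) hv
  set y := a * x + e with hy
  have hfin : ({y - a * y, 2 * x / a - y - a * y} : Set ℝ).Countable :=
    (Set.toFinite _).countable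
  filter_upwards [hfin.ae_notMem (gaussianReal 0 v)] with r hr h0
  change swapExponent (a ^ 2 / (2 * v)) (a / v) x y (a * y + r) = 0 at h0
  apply hr
  have hprod : (y - (a * y + r)) * (a * (y + (a * y + r)) - 2 * x) = 0 := by
    have : swapExponent (a ^ 2 / (2 * v)) (a / v) x y (a * y + r) =
        a / (2 * v) * ((y - (a * y + r)) * (a * (y + (a * y + r)) - 2 * x)) := by
      unfold swapExponent; field_simp; ring
    rw [this] at h0
    exact (mul_eq_zero.1 h0).resolve_left (div_ne_zero ha (mul_ne_zero two_ne_zero hv'))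
  rcases mul_eq_zero.1 hprod with h | h
  · left; linarith
  · right
    rw [Set.mem_singleton_iff]
    field_simp
    linarith

/-- The expected logarithm of a likelihood ratio score is nonnegative, and positive unless the
likelihood ratio is one. -/
theorem integral_logScore_nonneg {Ω : Type*} [MeasurableSpace Ω] {P : Measure Ω}
    [IsProbabilityMeasure P] {D : Ω → ℝ} (hD : Measurable D)
    (hone : ∫⁻ ω, ENNReal.ofReal (Real.exp (D ω)) ∂P = 1)
    (hint : Integrable (fun ω => logScore (D ω)) P) :
    0 ≤ ∫ ω, logScore (D ω) ∂P ∧ (∫ ω, logScore (D ω) ∂P = 0 → ∀ᵐ ω ∂P, D ω = 0) := by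
  have hexp : Integrable (fun ω => Real.exp (D ω)) P := by
    refine ⟨(Real.measurable_exp.comp hD).aestronglyMeasurable, ?_⟩
    rw [hasFiniteIntegral_iff_ofReal (ae_of_all _ fun ω => (Real.exp_pos _).le), hone]
    exact ENNReal.one_lt_top
  have hE : ∫ ω, Real.exp (D ω) ∂P = 1 := by
    rw [integral_eq_lintegral_of_nonneg_ae (ae_of_all _ fun ω => (Real.exp_pos _).le)
      hexp.aestronglyMeasurable, hone, ENNReal.toReal_one]
  have hlin : Integrable (fun ω => (1 - Real.exp (D ω)) / 2) P :=
    ((integrable_const 1).sub hexp).div_const 2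
  have hlin0 : ∫ ω, (1 - Real.exp (D ω)) / 2 ∂P = 0 := by
    rw [integral_div, integral_sub (integrable_const 1) hexp, hE]
    simp
  refine ⟨hlin0 ▸ integral_mono hlin hint fun ω => half_one_sub_exp_le_logScore _, fun h0 => ?_⟩
  have hsub : ∫ ω, (logScore (D ω) - (1 - Real.exp (D ω)) / 2) ∂P = 0 := by
    rw [integral_sub hint hlin, h0, hlin0, sub_zero]
  rw [integral_eq_zero_iff_of_nonneg
    (fun ω => sub_nonneg.2 (half_one_sub_exp_le_logScore _)) (hint.sub hlin)] at hsub
  filter_upwards [hsub] with ω hω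
  by_contra hne
  exact (sub_pos.2 (half_one_sub_exp_lt_logScore hne)).ne' hω

/-! ### The stationary Gaussian AR(1) process -/

namespace IsStationaryGaussianAR1

variable {Ω : Type*} [MeasurableSpace Ω] {P : Measure Ω}
  {X ε : ℕ → Ω → ℝ} {a σ : ℝ}

theorem hasLaw_innovation (hX : IsStationaryGaussianAR1 P X ε a σ) (t : ℕ) :
    HasLaw (ε (t + 2)) (gaussianReal 0 (σ ^ 2).toNNReal) P := by
  have e : (σ ^ 2).toNNReal = ⟨σ ^ 2, sq_nonneg σ⟩ := Real.toNNReal_of_nonneg (sq_nonneg σ)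
  rw [e]
  exact hX.innovation_law _ (by omega)

theorem ae_recursion (hX : IsStationaryGaussianAR1 P X ε a σ) :
    ∀ᵐ ω ∂P, ∀ t, X (t + 2) ω = a * X (t + 1) ω + ε (t + 2) ω :=
  ae_all_iff.2 fun t => hX.recursion (t + 1) (by omega)

theorem identDistrib_apply (hX : IsStationaryGaussianAR1 P X ε a σ) (t : ℕ) :
    IdentDistrib (X (t + 1)) (X 1) P P := by
  have := (hX.stationary t).comp (u := fun z : ℕ → ℝ => z 0) (by fun_prop)
  simpa [Function.comp_def, add_comm 1 t] using this

theorem indepFun_initial (hX : IsStationaryGaussianAR1 P X ε a σ) (t : ℕ) :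
    IndepFun (X 1) (ε (t + 2)) P :=
  hX.initial_indep.comp (φ := id) (ψ := fun z : ℕ → ℝ => z t) measurable_id (by fun_prop)

theorem charFun_initial [IsProbabilityMeasure P] (hX : IsStationaryGaussianAR1 P X ε a σ) (t : ℝ) :
    charFun (P.map (X 1)) t =
      charFun (P.map (X 1)) (a * t) * Complex.exp (-(σ ^ 2 * t ^ 2 / 2 : ℝ)) := by
  have mX := hX.measurable_X 1 le_rfl
  have e1 : P.map (X 1) = P.map (fun ω => a * X 1 ω + ε 2 ω) := by
    rw [← (hX.identDistrib_apply 1).map_eq]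
    exact Measure.map_congr (hX.recursion 1 le_rfl)
  have hind : IndepFun (fun ω => a * X 1 ω) (ε 2) P :=
    (hX.indepFun_initial 0).comp (φ := fun x => a * x) (ψ := id) (by fun_prop) measurable_id
  have e2 : P.map (fun ω => a * X 1 ω) = (P.map (X 1)).map (fun x => a * x) := by
    rw [Measure.map_map (by fun_prop) mX]
    rfl
  nth_rewrite 1 [e1]
  rw [hind.charFun_map_fun_add_eq_mul (mX.const_mul a).aemeasurable
    (hX.measurable_innovation 2 le_rfl).aemeasurable, Pi.mul_apply, e2, charFun_map_mul,
    (hX.hasLaw_innovation 0).map_eq, charFun_gaussianReal,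
    Real.coe_toNNReal _ (sq_nonneg σ)]
  congr 2
  push_cast
  simp

theorem isStableAR1 [IsProbabilityMeasure P] (hX : IsStationaryGaussianAR1 P X ε a σ) (hσ : 0 < σ) :
    IsStableAR1 P (fun t => X (t + 1)) (fun t => ε (t + 2)) a := by
  have mX := hX.measurable_X 1 le_rfl
  have : IsProbabilityMeasure (P.map (X 1)) := Measure.isProbabilityMeasure_map mX.aemeasurable
  have ha := abs_lt_one_of_charFun (by positivity : 0 < σ ^ 2) hX.charFun_initial
  have hlaw := eq_gaussianReal_of_charFun (by positivity : 0 < σ ^ 2) ha hX.charFun_initial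
  refine ⟨ha, fun t => hX.measurable_X _ (by omega), fun t => hX.measurable_innovation _ (by omega),
    hX.innovation_indep, fun t => (hX.innovation_law _ (by omega)).identDistrib
      (hX.innovation_law _ (by omega)), hX.ae_recursion, fun h => ?_, ?_⟩
  · simpa only [add_right_comm _ h 1] using hX.stationary h
  · have h2 : MemLp id 2 (P.map (X 1)) := by
      rw [hlaw]
      exact memLp_id_gaussianReal 2
    exact (memLp_map_measure_iff aestronglyMeasurable_id mX.aemeasurable).1 h2

theorem integral_innovation (hX : IsStationaryGaussianAR1 P X ε a σ) : ∫ ω, ε 2 ω ∂P = 0 := by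
  rw [(hX.hasLaw_innovation 0).integral_eq, integral_id_gaussianReal]

theorem integral_innovation_sq [IsProbabilityMeasure P] (hX : IsStationaryGaussianAR1 P X ε a σ) :
    ∫ ω, ε 2 ω ^ 2 ∂P = σ ^ 2 := by
  have h1 := (hX.hasLaw_innovation 0).variance_eq
  rw [variance_id_gaussianReal, Real.coe_toNNReal _ (sq_nonneg σ), variance_of_integral_eq_zero
    (hX.measurable_innovation 2 le_rfl).aemeasurable hX.integral_innovation] at h1
  exact h1

theorem tendsto_leastSquares [IsProbabilityMeasure P] (hX : IsStationaryGaussianAR1 P X ε a σ) (hσ : 0 < σ) :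
    ∀ᵐ ω ∂P, Tendsto (fun n => lsCoef X (n + 1) ω) atTop (𝓝 a) ∧
      Tendsto (fun n => lsVar X (n + 1) ω) atTop (𝓝 (σ ^ 2)) := by
  refine (hX.isStableAR1 hσ).tendsto_leastSquares (by positivity) ?_ hX.integral_innovation_sq
  rw [(hX.indepFun_initial 0).integral_fun_mul_eq_mul_integral
    (hX.measurable_X 1 le_rfl).aestronglyMeasurable
    (hX.measurable_innovation 2 le_rfl).aestronglyMeasurable, hX.integral_innovation, mul_zero]

/-- The joint law of the first value and the first two innovations. -/
theorem map_initial_innovations [IsProbabilityMeasure P] (hX : IsStationaryGaussianAR1 P X ε a σ) :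
    P.map (fun ω => (X 1 ω, ε 2 ω, ε 3 ω)) =
      (P.map (X 1)).prod ((gaussianReal 0 (σ ^ 2).toNNReal).prod
        (gaussianReal 0 (σ ^ 2).toNNReal)) := by
  have mX := (hX.measurable_X 1 le_rfl).aemeasurable (μ := P)
  have m2 := (hX.measurable_innovation 2 le_rfl).aemeasurable (μ := P)
  have m3 := (hX.measurable_innovation 3 (by omega)).aemeasurable (μ := P)
  have h1 : IndepFun (X 1) (fun ω => (ε 2 ω, ε 3 ω)) P :=
    hX.initial_indep.comp (φ := id) (ψ := fun z : ℕ → ℝ => (z 0, z 1)) measurable_id (by fun_prop)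
  have h2 : IndepFun (ε 2) (ε 3) P := hX.innovation_indep.indepFun (by decide : (0 : ℕ) ≠ 1)
  rw [h1.map_prod_eq_prod_map_map mX (m2.prodMk m3), h2.map_prod_eq_prod_map_map m2 m3,
    (hX.hasLaw_innovation 0).map_eq, (hX.hasLaw_innovation 1).map_eq]

theorem ae_arTriple (hX : IsStationaryGaussianAR1 P X ε a σ) :
    ∀ᵐ ω ∂P, arTriple a (X 1 ω, ε 2 ω, ε 3 ω) = (X 1 ω, X 2 ω, X 3 ω) := by
  filter_upwards [hX.ae_recursion] with ω hω
  rw [arTriple, ← hω 0, ← hω 1]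

/-- The mean of the oracle log-score, at the first three times. -/
theorem integral_logScore [IsProbabilityMeasure P] (hX : IsStationaryGaussianAR1 P X ε a σ) (hσ : 0 < σ) :
    0 ≤ ∫ ω, logScore (swapExponent (a ^ 2 / (2 * σ ^ 2)) (a / σ ^ 2) (X 1 ω) (X 2 ω) (X 3 ω)) ∂P ∧
    (∫ ω, logScore (swapExponent (a ^ 2 / (2 * σ ^ 2)) (a / σ ^ 2) (X 1 ω) (X 2 ω) (X 3 ω)) ∂P = 0 ↔
      a = 0) := by
  have mX := fun t (ht : 1 ≤ t) => hX.measurable_X t ht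
  have : IsProbabilityMeasure (P.map (X 1)) :=
    Measure.isProbabilityMeasure_map (mX 1 le_rfl).aemeasurable
  have hv : (σ ^ 2).toNNReal ≠ 0 := (Real.toNNReal_pos.2 (by positivity)).ne'
  have hvc : ((σ ^ 2).toNNReal : ℝ) = σ ^ 2 := Real.coe_toNNReal _ (sq_nonneg σ)
  have hT := measurable_arTriple a
  have hD := (measurable_swapExponent (a ^ 2 / (2 * σ ^ 2)) (a / σ ^ 2))
  have mW : Measurable fun ω => (X 1 ω, ε 2 ω, ε 3 ω) := (mX 1 le_rfl).prodMk
    ((hX.measurable_innovation 2 le_rfl).prodMk (hX.measurable_innovation 3 (by omega)))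
  have mU : Measurable fun ω => (X 1 ω, X 2 ω, X 3 ω) :=
    (mX 1 le_rfl).prodMk ((mX 2 (by omega)).prodMk (mX 3 (by omega)))
  have hone : ∫⁻ ω, ENNReal.ofReal (Real.exp (swapExponent (a ^ 2 / (2 * σ ^ 2)) (a / σ ^ 2)
      (X 1 ω) (X 2 ω) (X 3 ω))) ∂P = 1 := by
    have hDT : Measurable fun w => ENNReal.ofReal (Real.exp (swapExponent (a ^ 2 / (2 * σ ^ 2))
        (a / σ ^ 2) (arTriple a w).1 (arTriple a w).2.1 (arTriple a w).2.2)) :=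
      (hD.comp hT).exp.ennreal_ofReal
    rw [← lintegral_exp_swapExponent (P.map (X 1)) a hv, ← hX.map_initial_innovations, hvc,
      lintegral_map hDT mW]
    refine lintegral_congr_ae ?_
    filter_upwards [hX.ae_arTriple] with ω hω
    rw [hω]
  obtain ⟨C, hC, hg⟩ := exists_isQuadraticGrowth_logScore (a ^ 2 / (2 * σ ^ 2)) (a / σ ^ 2)
  have hint := (hX.isStableAR1 hσ).integrable_comp_window hg 0
  have hpos := integral_logScore_nonneg (hD.comp mU) hone (by simpa using hint)
  refine ⟨hpos.1, fun h0 => ?_, fun h0 => by simp [h0, swapExponent, logScore_zero]⟩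
  by_contra ha
  have hne := ae_swapExponent_ne_zero (P.map (X 1)) ha hv
  rw [← hX.map_initial_innovations, hvc] at hne
  have hfalse : ∀ᵐ ω ∂P, False := by
    filter_upwards [ae_of_ae_map mW.aemeasurable hne, hX.ae_arTriple, hpos.2 h0] with ω h1 h2 h3
    rw [h2] at h1
    exact h1 h3
  exact hfalse.exists.elim fun _ h => h

theorem iIndepFun_of_eq_zero [IsProbabilityMeasure P] (hX : IsStationaryGaussianAR1 P X ε a σ) (ha : a = 0) :
    iIndepFun (fun t : ℕ => X (t + 1)) P ∧
      ∀ t, 1 ≤ t → HasLaw (X t) (gaussianReal 0 ⟨σ ^ 2, sq_nonneg σ⟩) P := by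
  have hmX : ∀ t, Measurable (X (t + 1)) := fun t => hX.measurable_X _ (by omega)
  have hmε : ∀ t, Measurable (ε (t + 2)) := fun t => hX.measurable_innovation _ (by omega)
  have heq : ∀ᵐ ω ∂P, (fun t : ℕ => X (t + 1 + 1) ω) = fun t : ℕ => ε (t + 2) ω := by
    filter_upwards [hX.ae_recursion] with ω hω
    funext t
    rw [hω t, ha, zero_mul, zero_add]
  have hseq : P.map (fun ω (t : ℕ) => X (t + 1) ω) = P.map (fun ω (t : ℕ) => ε (t + 2) ω) := by
    rw [← (hX.stationary 1).map_eq]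
    exact Measure.map_congr heq
  have hlaw : ∀ t, P.map (X (t + 1)) = P.map (ε (t + 2)) := by
    intro t
    have h1 := congrArg (Measure.map fun z : ℕ → ℝ => z t) hseq
    rwa [Measure.map_map (by fun_prop) (measurable_pi_lambda _ hmX),
      Measure.map_map (by fun_prop) (measurable_pi_lambda _ hmε)] at h1
  refine ⟨?_, fun t ht => ⟨(hX.measurable_X t ht).aemeasurable, ?_⟩⟩
  · rw [iIndepFun_iff_map_fun_eq_infinitePi_map hmX, hseq,
      hX.innovation_indep.map_fun_eq_infinitePi_map hmε]
    simp_rw [hlaw]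
  · obtain ⟨s, rfl⟩ := Nat.exists_eq_add_of_le' ht
    rw [hlaw, (hX.innovation_law _ (by omega)).map_eq]

/-- The averages of the plug-in log-scores converge to the mean of the oracle log-score. -/
theorem tendsto_average_plugInScore [IsProbabilityMeasure P] (hX : IsStationaryGaussianAR1 P X ε a σ) (hσ : 0 < σ) :
    ∀ᵐ ω ∂P, Tendsto (fun n : ℕ =>
      (∑ k ∈ Finset.range n, Real.log (plugInScore X (2 * (k + 2)) ω)) / (n : ℝ)) atTop
      (𝓝 (∫ ω, logScore (swapExponent (a ^ 2 / (2 * σ ^ 2)) (a / σ ^ 2)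
        (X 1 ω) (X 2 ω) (X 3 ω)) ∂P)) := by
  have hZ := hX.isStableAR1 hσ
  have hσ2 : σ ^ 2 ≠ 0 := by positivity
  obtain ⟨C, hC, hg⟩ := exists_isQuadraticGrowth_logScore (a ^ 2 / (2 * σ ^ 2)) (a / σ ^ 2)
  filter_upwards [hZ.tendsto_average hC hg two_pos 1, hX.tendsto_leastSquares hσ,
    hZ.ae_exists_sum_sq_le] with ω hω ⟨hcoef, hvar⟩ ⟨K, hK⟩
  have hK0 : 0 ≤ K := by simpa using hK 0
  have hidx : Tendsto (fun k : ℕ => 2 * k + 1) atTop atTop :=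
    tendsto_atTop_mono (fun k => show k ≤ 2 * k + 1 by omega) tendsto_id
  have hcoef' := hcoef.comp hidx
  have hvar' := hvar.comp hidx
  have hα := ((hcoef'.pow 2).div (hvar'.const_mul 2) (mul_ne_zero two_ne_zero hσ2)).sub_const
    (a ^ 2 / (2 * σ ^ 2))
  have hβ := (hcoef'.div hvar' hσ2).sub_const (a / σ ^ 2)
  have hδ := hα.abs.add hβ.abs
  rw [sub_self, sub_self, abs_zero, add_zero] at hδ
  refine tendsto_average_of_vanishing_error
    (q := fun k => X (2 * k + 1 + 0 + 1) ω ^ 2 + X (2 * k + 1 + 1 + 1) ω ^ 2 +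
      X (2 * k + 1 + 2 + 1) ω ^ 2) (K := 3 * (K * 6))
    (fun k => by positivity) (fun n => ?_) hδ ?_ hω
  · have h := fun j : ℕ => (sum_stride_le (z := fun t => X (t + 1) ω ^ 2) (fun t => sq_nonneg _)
      two_pos (1 + j) n).trans (hK (2 * n + (1 + j)))
    have hb : ∀ j : ℕ, j ≤ 2 →
        K * (((2 * n + (1 + j) : ℕ) : ℝ) + 1) ≤ K * 6 * ((n : ℝ) + 1) := by
      intro j hj
      have hj' : (j : ℝ) ≤ 2 := by exact_mod_cast hj
      rw [mul_assoc]
      refine mul_le_mul_of_nonneg_left ?_ hK0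
      push_cast
      linarith [Nat.cast_nonneg (α := ℝ) n]
    rw [Finset.sum_add_distrib, Finset.sum_add_distrib]
    have h0 := (h 0).trans (hb 0 (by norm_num))
    have h1 := (h 1).trans (hb 1 (by norm_num))
    have h2 := (h 2).trans (hb 2 (by norm_num))
    simp only [← add_assoc] at h0 h1 h2
    linarith
  · filter_upwards [hvar'.eventually_ne hσ2] with k hk
    have hk' : lsVar X (2 * k + 1 + 1) ω ≠ 0 := hk
    have e : 2 * (k + 2) - 2 = 2 * k + 1 + 1 := by omega
    have e1 : 2 * (k + 2) - 1 = 2 * k + 1 + 1 + 1 := by omega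
    have e2 : 2 * (k + 2) = 2 * k + 1 + 2 + 1 := by ring
    rw [plugInScore, e, e1, if_neg hk', log_pairScore _ hk', e2]
    exact (abs_logScore_sub_le _ _).trans (abs_swapExponent_sub_le _ _ _ _ _ _ _)

end IsStationaryGaussianAR1

theorem plugInScore_pos {Ω : Type*} (X : ℕ → Ω → ℝ) (k : ℕ) (ω : Ω) : 0 < plugInScore X k ω := by
  rw [plugInScore]
  split_ifs with h
  · exact one_pos
  · exact pairScore_pos _ h _ _ _

theorem log_pairWealth_succ {Ω : Type*} (X : ℕ → Ω → ℝ) (n : ℕ) (ω : Ω) :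
    Real.log (pairWealth X (n + 1) ω) =
      ∑ k ∈ Finset.range n, Real.log (plugInScore X (2 * (k + 2)) ω) := by
  rw [pairWealth, Real.log_prod fun i _ => (plugInScore_pos X _ ω).ne',
    ← Finset.Ico_add_one_right_eq_Icc, Finset.sum_Ico_eq_sum_range]
  exact Finset.sum_congr (by congr 1) fun k _ => by rw [add_comm 2 k]

theorem theorem2p3 {Ω : Type*} [MeasurableSpace Ω] (P : Measure Ω) [IsProbabilityMeasure P]
    (X ε : ℕ → Ω → ℝ) (a σ : ℝ) (hσ : 0 < σ) (hX : IsStationaryGaussianAR1 P X ε a σ) :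
    Integrable (fun ω => Real.log (oracleScore a (σ ^ 2) X 4 ω)) P ∧
    (∀ᵐ ω ∂P, Tendsto (fun n : ℕ => Real.log (pairWealth X n ω) / (2 * (n : ℝ))) atTop
      (𝓝 (growthRate P X a (σ ^ 2)))) ∧
    0 ≤ growthRate P X a (σ ^ 2) ∧
    (growthRate P X a (σ ^ 2) = 0 ↔ a = 0) ∧
    (a = 0 → iIndepFun (fun t : ℕ => X (t + 1)) P ∧
      ∀ t, 1 ≤ t → HasLaw (X t) (gaussianReal 0 ⟨σ ^ 2, sq_nonneg σ⟩) P) := by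
  have hZ := hX.isStableAR1 hσ
  have hσ2 : σ ^ 2 ≠ 0 := by positivity
  obtain ⟨C, hC, hg⟩ := exists_isQuadraticGrowth_logScore (a ^ 2 / (2 * σ ^ 2)) (a / σ ^ 2)
  have hlog : ∀ ω, Real.log (oracleScore a (σ ^ 2) X 4 ω) =
      logScore (swapExponent (a ^ 2 / (2 * σ ^ 2)) (a / σ ^ 2) (X 2 ω) (X 3 ω) (X 4 ω)) :=
    fun ω => log_pairScore _ hσ2 _ _ _
  have hrate : growthRate P X a (σ ^ 2) = 1 / 2 * ∫ ω, logScore (swapExponent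
      (a ^ 2 / (2 * σ ^ 2)) (a / σ ^ 2) (X 1 ω) (X 2 ω) (X 3 ω)) ∂P := by
    rw [growthRate]
    simp_rw [hlog]
    congr 1
    exact ((hZ.identDistrib_window 3 1).comp hg.continuous.measurable).integral_eq
  have hmean := hX.integral_logScore hσ
  refine ⟨?_, ?_, ?_, ?_, hX.iIndepFun_of_eq_zero⟩
  · simp_rw [hlog]
    exact hZ.integrable_comp_window hg 1
  · filter_upwards [hX.tendsto_average_plugInScore hσ] with ω hω
    rw [← tendsto_add_atTop_iff_nat 1, hrate]
    have h1 : Tendsto (fun n : ℕ => (n : ℝ) / ((n : ℝ) + 1)) atTop (𝓝 1) :=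
      tendsto_natCast_div_add_atTop 1
    have h2 := (h1.const_mul (1 / 2)).mul hω
    rw [mul_one] at h2
    refine h2.congr' ?_
    filter_upwards [eventually_gt_atTop 0] with n hn
    have hn' : (0 : ℝ) < n := by exact_mod_cast hn
    rw [log_pairWealth_succ]
    push_cast
    field_simp
  · rw [hrate]
    exact mul_nonneg (by norm_num) hmean.1
  · rw [hrate, mul_eq_zero, or_iff_right (by norm_num)]
    exact hmean.2
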